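/- For a finite graph $G$ and $k\ge 1$, let $\Delta_k^t(G)$ be the total $k$-cut complex of $G$: the simplicial complex (with the empty set counted as a face) whose facets are the sets $F\subseteq V(G)$ such that $|V(G)\setminus F|=k$ and $V(G)\setminus F$ spans no edge of $G$. Let $m\ge 2$ and $n\ge 4$, and let $K_m\,\square\,C_n$ be the Cartesian product of the complete graph on $\{0,\dots,m-1\}$ and the cycle graph on $\{0,\dots,n-1\}$. Put $\Delta=\Delta_2^t(K_m\,\square\,C_n)$. **(1)** (The geometric realization of) $\Delta$ is homotopy equivalent to a wedge of spheres: $$\Delta\;\simeq\;\bigvee_{n(m-1)+1}\mathbb S^{mn-4}.$$ **(2)** Let $\mathcal C_0=\Delta$ (as a set of faces) and, for $0\le j\le n-1$, let $\mathcal M_j$ be the set of all pairs $\{\sigma\setminus\{(0,j)\},\,\sigma\cup\{(0,j)\}\}$ whose two members both lie in $\mathcal C_j$, and let $\mathcal C_{j+1}$ be the set of all $\sigma\in\mathcal C_j$ that belong to no pair of $\mathcal M_j$. Then $\mathcal M=\bigcup_{j=0}^{n-1}\mathcal M_j$ is an acyclic matching on $\Delta$; that is, every pair in $\mathcal M$ consists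 of two faces of $\Delta$ one of which covers the other under inclusion, no face lies in more than one pair, and there is no cycle $\tau_1\succ\sigma_1\prec\tau_2\succ\sigma_2\prec\cdots\prec\tau_t\succ\sigma_t\prec\tau_1$ with $t\ge2$, the $\sigma_i$ distinct, and all $\{\sigma_i,\tau_i\}\in\mathcal M$ (here $\prec$ is the covering relation). Its critical faces, i.e. the faces of $\Delta$ lying in no pair of $\mathcal M$, are exactly the sets $\sigma\subseteq V(K_m\,\square\,C_n)$ whose complement is one of the following: * $\{(0,0),(i,j-1),(i,j)\}$ with $1\le i\le m-1$ and $1\le j\le n-1$ ($(m-1)(n-1)$ faces); * $\{(0,0),(i,0),(i,n-1)\}$ with $1\le i\le m-1$ ($m-1$ faces); * $\{(0,0),(0,n-2),(0,n-1)\}$ (one face). These are $n(m-1)+1$ faces in all, each with $mn-3$ vertices, i.e. of dimension $mn-4$. -/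

import Mathlib

open scoped ContinuousMap

/-! ### Total cut complexes and geometric realization -/

/-- The total `k`-cut complex of a finite graph `G`. Its facets are the sets `F` of vertices whose
complement has exactly `k` elements and spans no edge of `G`; its faces are all the subsets of the
facets, the empty set included. An abstract simplicial complex on the vertex set `V` is a family of
finite subsets of `V` closed under passing to subsets, that is, a `LowerSet (Finset V)`. -/
def totalCutComplex {V : Type*} [Fintype V] [DecidableEq V] (k : ℕ) (G : SimpleGraph V) :
    LowerSet (Finset V) where
  carrier := {σ | ∃ F : Finset V, σ ⊆ F ∧ Fᶜ.card = k ∧ G.IsIndepSet (↑(Fᶜ) : Set V)}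
  lower' := by
    rintro σ τ hτσ ⟨F, hσF, hF⟩
    exact ⟨F, Finset.Subset.trans hτσ hσF, hF⟩

/-- The geometric realization of a simplicial complex on a finite vertex set `V`: the points of the
standard simplex in `ℝ^V` whose support is contained in a face. It is used as a topological space
with the topology induced from `ℝ^V`. -/
def geometricRealization {V : Type*} [Fintype V] (K : LowerSet (Finset V)) : Set (V → ℝ) :=
  {x | x ∈ stdSimplex ℝ V ∧ ∃ σ ∈ K, ∀ v, x v ≠ 0 → v ∈ σ}

/-! ### Wedges of spheres -/

/-- The identifications that define a wedge: an extra point `inl ()` is glued to the base point of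
every summand. -/
inductive WedgeRel {ι : Type*} {X : ι → Type*} (p : ∀ i, X i) :
    Unit ⊕ (Σ i, X i) → Unit ⊕ (Σ i, X i) → Prop
  | base (i : ι) : WedgeRel p (Sum.inl ()) (Sum.inr ⟨i, p i⟩)

/-- The wedge of a family of spaces `X i` with base points `p i`. The empty wedge is a point. -/
def Wedge {ι : Type*} {X : ι → Type*} (p : ∀ i, X i) : Type _ := Quot (WedgeRel p)

/-- The wedge carries the quotient topology of the disjoint union. -/
instance {ι : Type*} {X : ι → Type*} [∀ i, TopologicalSpace (X i)] (p : ∀ i, X i) :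
    TopologicalSpace (Wedge p) :=
  inferInstanceAs (TopologicalSpace (Quot (WedgeRel p)))

/-- The unit sphere of dimension `d`, in the Euclidean space of dimension `d + 1`. -/
abbrev UnitSphere (d : ℕ) : Type := Metric.sphere (0 : EuclideanSpace ℝ (Fin (d + 1))) 1

/-- The first standard basis vector, the base point of the unit sphere. -/
noncomputable def UnitSphere.basePoint (d : ℕ) : UnitSphere d :=
  ⟨EuclideanSpace.single 0 1, by simp⟩

/-- The wedge of `r` spheres of dimension `d`. -/
abbrev WedgeOfSpheres (r d : ℕ) : Type :=
  Wedge (fun _ : Fin r => UnitSphere.basePoint d)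

/-! ### Matchings on a family of finite sets -/

section Matching

variable {X : Type*}

/-- `τ` covers `σ` in the family `S`, that is, `σ ⊂ τ` and no member of `S` lies strictly
between them. -/
def CoveredIn (S : Set (Finset X)) (σ τ : Finset X) : Prop :=
  σ ⊂ τ ∧ ∀ ρ ∈ S, ¬ (σ ⊂ ρ ∧ ρ ⊂ τ)

/-- `M` is a partial matching on the family `S`: a set of unordered pairs of members of `S`, such
that one member of each pair covers the other and no set lies in more than one pair. -/
structure IsPartialMatching (S : Set (Finset X)) (M : Set (Sym2 (Finset X))) : Prop where
  mem_of_mem : ∀ e ∈ M, ∀ σ ∈ e, σ ∈ S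
  eq_of_mem : ∀ e ∈ M, ∀ e' ∈ M, ∀ σ, σ ∈ e → σ ∈ e' → e = e'
  covered : ∀ σ τ, s(σ, τ) ∈ M → CoveredIn S σ τ ∨ CoveredIn S τ σ

/-- `M` is an acyclic matching on `S`: a partial matching for which there is no cycle
`τ₁ ≻ σ₁ ≺ τ₂ ≻ σ₂ ≺ ⋯ ≺ τₜ ≻ σₜ ≺ τ₁` with `t ≥ 2`, with distinct `σᵢ`, and with every
`{σᵢ, τᵢ}` a pair of `M`. -/
structure IsAcyclicMatching (S : Set (Finset X)) (M : Set (Sym2 (Finset X))) : Prop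
    extends IsPartialMatching S M where
  acyclic : ∀ t : ℕ, 2 ≤ t → ¬ ∃ σ τ : Fin t → Finset X, Function.Injective σ ∧
    ∀ i, s(σ i, τ i) ∈ M ∧ CoveredIn S (σ i) (τ i) ∧ CoveredIn S (σ i) (τ (finRotate t i))

/-- The critical (that is, unmatched) members of `S` with respect to `M`. -/
def criticalSets (S : Set (Finset X)) (M : Set (Sym2 (Finset X))) : Set (Finset X) :=
  {σ ∈ S | ∀ e ∈ M, σ ∉ e}

variable [DecidableEq X]

/-- The element matching on `S` using `x`: all the pairs `{σ ∖ {x}, σ ∪ {x}}` whose two members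
both belong to `S`. -/
def elementMatching (S : Set (Finset X)) (x : X) : Set (Sym2 (Finset X)) :=
  {e | ∃ σ : Finset X, σ.erase x ∈ S ∧ insert x σ ∈ S ∧ e = s(σ.erase x, insert x σ)}

/-- The union of the successive element matchings using the vertices of a list: first the element
matching on `S` using the head of the list, then the one using the next vertex on the family of the
sets which are still unmatched, and so on. -/
def sequentialMatching (S : Set (Finset X)) : List X → Set (Sym2 (Finset X))
  | [] => ∅
  | x :: l => elementMatching S x ∪
      sequentialMatching (criticalSets S (elementMatching S x)) l

end Matching

/-! ### The product of a complete graph and a cycle -/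

/-- The Cartesian product of the complete graph on `{0, …, m - 1}` and the cycle on
`{0, …, n - 1}`. -/
abbrev completeBoxCycle (m n : ℕ) : SimpleGraph (Fin m × Fin n) :=
  (⊤ : SimpleGraph (Fin m)) □ SimpleGraph.cycleGraph n

section Product

variable (m n : ℕ) [NeZero m] [NeZero n]

/-- The union of the successive element matchings on the total `2`-cut complex of the product,
using the vertices `(0, 0), (0, 1), …, (0, n - 1)` in this order. -/
def productMatching : Set (Sym2 (Finset (Fin m × Fin n))) :=
  sequentialMatching (totalCutComplex 2 (completeBoxCycle m n) : Set (Finset (Fin m × Fin n)))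
    ((List.finRange n).map fun j => ((0 : Fin m), j))

/-- The sets with complement `{(0, 0), (i, j - 1), (i, j)}`, where `1 ≤ i ≤ m - 1` and
`1 ≤ j ≤ n - 1`. -/
def pathTypeFaces : Set (Finset (Fin m × Fin n)) :=
  {σ | ∃ i : Fin m, i ≠ 0 ∧ ∃ j' j : Fin n, j'.val + 1 = j.val ∧
    σᶜ = {(0, 0), (i, j'), (i, j)}}

/-- The sets with complement `{(0, 0), (i, 0), (i, n - 1)}`, where `1 ≤ i ≤ m - 1`. -/
def wrapFaces : Set (Finset (Fin m × Fin n)) :=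
  {σ | ∃ i : Fin m, i ≠ 0 ∧ ∃ l : Fin n, l.val + 1 = n ∧ σᶜ = {(0, 0), (i, 0), (i, l)}}

/-- The sets with complement `{(0, 0), (0, n - 2), (0, n - 1)}`. -/
def rowFaces : Set (Finset (Fin m × Fin n)) :=
  {σ | ∃ l' l : Fin n, l'.val + 2 = n ∧ l.val + 1 = n ∧ σᶜ = {(0, 0), (0, l'), (0, l)}}

end Product

/-! A set is a face of the complex exactly when its complement is not a clique. Let `x = (0, 0)`. A
face outside the star of `x` has complement `{x} ∪ B` with `B` a clique avoiding `x` and containing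
a non-neighbour of `x`; such a `B` is a relative cell and the face is `cutFace B`. Because `n ≥ 4`,
a clique is either contained in a column or an edge of a row.

Toggling `x` matches the whole star of `x`. Toggling `(0, k)` with `k ≥ 1` matches the subsets of
column `k` that have a vertex outside row `0` (`IsColumnPair`), and matches `{(0, k + 1)}` with
`{(0, k), (0, k + 1)}` for `1 ≤ k ≤ n - 3` (`IsRowPair`). What survives is every row edge outside
row `0` and the one edge `{(0, n - 2), (0, n - 1)}` of row `0` (`IsRelativeCell.isCriticalCell`).
Acyclicity holds for any sequence of element matchings: the first element used along a cycle could
never be put back (`sequentialMatching_no_cycle`).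

The homotopy type is obtained by explicit maps. Row pairs and then column pairs are removed by
elementary collapses (`toggle_collapse`). The remaining complex is a cone with apex `x` together
with the critical faces, which are maximal, of equal dimension, and have their boundary in the cone.
Pushing everything outside the open critical simplices to `x` identifies it up to homotopy with the
wedge of the boundaries of the simplices `insert x (C i)` (`homotopyEquiv_wedgeOfSpheres`), and each
boundary is a sphere. -/

/-! ### Geometric realizations and collapses -/

section Collapse

variable {V : Type*}

/-- Two maps into a set of `ℝ^V` are homotopic, relative to the set where they agree, if the
segments between their values stay in the set. -/
theorem homotopicRel_of_segment {A : Type*} [TopologicalSpace A] {Y : Set (V → ℝ)}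
    (f g : C(A, Y)) (S : Set A) (hS : ∀ a ∈ S, f a = g a)
    (h : ∀ a, ∀ t : ℝ, 0 ≤ t → t ≤ 1 → (1 - t) • (f a : V → ℝ) + t • (g a : V → ℝ) ∈ Y) :
    f.HomotopicRel g S := by
  refine ⟨⟨⟨⟨fun p => ⟨(1 - (p.1 : ℝ)) • (f p.2 : V → ℝ) + (p.1 : ℝ) • (g p.2 : V → ℝ),
    h p.2 p.1 p.1.2.1 p.1.2.2⟩, ?_⟩, ?_, ?_⟩, ?_⟩⟩
  · fun_prop
  · intro a; ext; simp
  · intro a; ext; simp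
  · intro t a ha
    have h1 := hS a ha
    ext u
    simp [← h1]
    ring

theorem continuous_inf' {σ : Finset V} (hσ : σ.Nonempty) :
    Continuous fun p : V → ℝ => σ.inf' hσ p := by
  apply Continuous.finset_inf'_apply
  intro i _
  fun_prop

variable [Fintype V]

theorem geometricRealization_mono {K L : LowerSet (Finset V)} (h : K ≤ L) :
    geometricRealization K ⊆ geometricRealization L :=
  fun _ hp => ⟨hp.1, hp.2.imp fun _ hσ => ⟨h hσ.1, hσ.2⟩⟩

theorem segment_mem_geometricRealization {K : LowerSet (Finset V)} {p q : V → ℝ}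
    {σ : Finset V} (hσ : σ ∈ K) (hp : p ∈ stdSimplex ℝ V) (hq : q ∈ stdSimplex ℝ V)
    (hpσ : ∀ v, p v ≠ 0 → v ∈ σ) (hqσ : ∀ v, q v ≠ 0 → v ∈ σ)
    {t : ℝ} (h0 : 0 ≤ t) (h1 : t ≤ 1) :
    (1 - t) • p + t • q ∈ geometricRealization K := by
  refine ⟨convex_stdSimplex ℝ V hp hq (by linarith) h0 (by ring), σ, hσ, fun v hv => ?_⟩
  by_contra hvσ
  have e1 : p v = 0 := by by_contra h; exact hvσ (hpσ v h)
  have e2 : q v = 0 := by by_contra h; exact hvσ (hqσ v h)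
  simp [e1, e2] at hv

theorem inf'_nonneg_of_stdSimplex {σ : Finset V} (hσ : σ.Nonempty) {p : V → ℝ}
    (hp : p ∈ stdSimplex ℝ V) : 0 ≤ σ.inf' hσ p :=
  (Finset.le_inf'_iff hσ _).2 fun u _ => hp.1 u

variable [DecidableEq V]

/-- The displacement that lowers all coordinates in `σ` by `s` and moves the mass to `v`. -/
def pushOff (σ : Finset V) (v : V) (s : ℝ) (p : V → ℝ) : V → ℝ :=
  fun u => p u - (if u ∈ σ then s else 0) + (if u = v then σ.card * s else 0)

theorem pushOff_mem_stdSimplex {σ : Finset V} {v : V} {s : ℝ} {p : V → ℝ}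
    (hp : p ∈ stdSimplex ℝ V) (hs : 0 ≤ s) (h : ∀ u ∈ σ, s ≤ p u) :
    pushOff σ v s p ∈ stdSimplex ℝ V := by
  constructor
  · intro u
    have h1 := hp.1 u
    have h2 : (0 : ℝ) ≤ σ.card * s := by positivity
    unfold pushOff
    split_ifs with hu hv hv
    · linarith [h u hu]
    · linarith [h u hu]
    · linarith
    · linarith
  · unfold pushOff
    rw [Finset.sum_add_distrib, Finset.sum_sub_distrib, hp.2]
    simp

/-- An elementary collapse is a homotopy equivalence. -/
theorem elementary_collapse {K L : LowerSet (Finset V)} {σ : Finset V} {v : V}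
    (hne : σ.Nonempty) (hv : v ∉ σ) (hσ : insert v σ ∈ K)
    (hfree : ∀ ρ ∈ K, σ ⊆ ρ → ρ = σ ∨ ρ = insert v σ)
    (hL : ∀ ρ, ρ ∈ L ↔ ρ ∈ K ∧ ¬ σ ⊆ ρ) :
    Nonempty (geometricRealization K ≃ₕ geometricRealization L) := by
  have hLK : L ≤ K := fun ρ hρ => ((hL ρ).1 hρ).1
  -- The retraction lowers the coordinates in `σ` by their minimum `μ` and gives the mass to `v`.
  -- Where `μ` is nonzero the support contains `σ`, so freeness puts it inside `insert v σ`; all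
  -- other points stay fixed.
  set μ : (V → ℝ) → ℝ := fun p => σ.inf' hne p with hμ
  have hμle : ∀ p : V → ℝ, ∀ u ∈ σ, μ p ≤ p u := fun p u hu => Finset.inf'_le _ hu
  have hzero : ∀ p ∈ geometricRealization L, μ p = 0 := by
    rintro p ⟨hp, ρ, hρ, hs⟩
    obtain ⟨u, hu, huρ⟩ := Finset.not_subset.1 ((hL ρ).1 hρ).2
    have : p u = 0 := by by_contra h; exact huρ (hs u h)
    exact le_antisymm (this ▸ hμle p u hu) (inf'_nonneg_of_stdSimplex hne hp)
  have hcase : ∀ p ∈ geometricRealization K, μ p = 0 ∨ ∀ u, p u ≠ 0 → u ∈ insert v σ := by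
    rintro p ⟨hp, ρ, hρ, hs⟩
    by_cases hsub : σ ⊆ ρ
    · right
      intro u hu
      rcases hfree ρ hρ hsub with h | h
      · exact Finset.mem_insert_of_mem (h ▸ hs u hu)
      · exact h ▸ hs u hu
    · left
      exact hzero p ⟨hp, ρ, (hL ρ).2 ⟨hρ, hsub⟩, hs⟩
  have hpush0 : ∀ p : V → ℝ, pushOff σ v 0 p = p := by
    intro p; ext u; simp [pushOff]
  have hr : ∀ p ∈ geometricRealization K, pushOff σ v (μ p) p ∈ geometricRealization L := by
    intro p hpK
    have hmem := pushOff_mem_stdSimplex (v := v) hpK.1 (inf'_nonneg_of_stdSimplex hne hpK.1)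
      (hμle p)
    -- The coordinate `w` realizing the minimum vanishes after the push, so the image is carried by
    -- a face that omits `w` and hence does not contain `σ`.
    obtain ⟨w, hw, hwe⟩ := Finset.exists_mem_eq_inf' hne p
    have hwe' : μ p = p w := hwe
    have hwv : w ≠ v := fun h => hv (h ▸ hw)
    by_cases hs : ∀ u, p u ≠ 0 → u ∈ insert v σ
    · refine ⟨hmem, (insert v σ).erase w, (hL _).2 ⟨K.lower (Finset.erase_subset _ _) hσ, ?_⟩, ?_⟩
      · exact fun h => by simpa using h hw
      · intro u hu
        rw [Finset.mem_erase]
        constructor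
        · rintro rfl
          apply hu
          simp [pushOff, hw, hwv, hwe']
        · by_contra huσ
          apply hu
          have : p u = 0 := by by_contra h; exact huσ (hs u h)
          rw [Finset.mem_insert, not_or] at huσ
          simp [pushOff, this, huσ.1, huσ.2]
    · have h0 := (hcase p hpK).resolve_right hs
      obtain ⟨hp, ρ, hρ, hsρ⟩ := hpK
      have hpw : p w = 0 := by rw [← hwe', h0]
      refine ⟨hmem, ρ.erase w, (hL _).2 ⟨K.lower (Finset.erase_subset _ _) hρ, ?_⟩, ?_⟩
      · exact fun h => by simpa using h hw
      · intro u hu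
        rw [h0, hpush0] at hu
        exact Finset.mem_erase.2 ⟨fun h => hu (h ▸ hpw), hsρ u hu⟩
  have hcont : Continuous fun p : V → ℝ => pushOff σ v (μ p) p := by
    have := continuous_inf' hne
    refine continuous_pi fun u => ?_
    unfold pushOff
    split_ifs <;> fun_prop
  let r : C(geometricRealization K, geometricRealization L) :=
    ⟨fun p => ⟨pushOff σ v (μ p) p, hr p p.2⟩,
      (hcont.comp continuous_subtype_val).subtype_mk _⟩
  let j : C(geometricRealization L, geometricRealization K) :=
    ⟨Set.inclusion (geometricRealization_mono hLK), continuous_inclusion _⟩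
  refine ⟨⟨r, j, ?_, ?_⟩⟩
  · refine (homotopicRel_of_segment _ _ ∅ (by simp) ?_).homotopic
    rintro ⟨p, hp⟩ t h0 h1
    change (1 - t) • (pushOff σ v (μ p) p) + t • p ∈ _
    by_cases hs : ∀ u, p u ≠ 0 → u ∈ insert v σ
    · refine segment_mem_geometricRealization hσ (hr p hp).1 hp.1 ?_ hs h0 h1
      intro u hu
      by_contra huσ
      apply hu
      have : p u = 0 := by by_contra h; exact huσ (hs u h)
      rw [Finset.mem_insert, not_or] at huσ
      simp [pushOff, this, huσ.1, huσ.2]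
    · have h0 := (hcase p hp).resolve_right hs
      rw [h0, hpush0, ← add_smul]
      simpa using hp
  · convert ContinuousMap.Homotopic.refl _ using 1
    ext ⟨p, hp⟩ u
    change p u = pushOff σ v (μ p) p u
    rw [hzero p hp, hpush0]

/-- A subcomplex whose complement is closed under adding and removing a fixed vertex has the same
homotopy type. -/
theorem toggle_collapse {K L : LowerSet (Finset V)} (v : V) (hLK : L ≤ K) (hbot : ∅ ∈ L)
    (htog : ∀ σ ∈ K, σ ∉ L →
      insert v σ ∈ K ∧ σ.erase v ∉ L) :
    Nonempty (geometricRealization K ≃ₕ geometricRealization L) := by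
  classical
  generalize hN : (Finset.univ.filter fun σ => σ ∈ K ∧ σ ∉ L).card = N
  induction N using Nat.strong_induction_on generalizing K with
  | _ N ih =>
  by_cases hKL : K ≤ L
  · rw [le_antisymm hKL hLK]
    exact ⟨ContinuousMap.HomotopyEquiv.refl _⟩
  obtain ⟨τ, hτK, hτL⟩ := Set.not_subset.1 hKL
  have hτe : τ.erase v ∈ Finset.univ.filter fun σ => v ∉ σ ∧ σ ∈ K ∧ σ ∉ L := by
    simp only [Finset.mem_filter, Finset.mem_univ, true_and]
    exact ⟨by simp, K.lower (Finset.erase_subset _ _) hτK, (htog τ hτK hτL).2⟩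
  -- Take `σ` maximal among the faces to be removed that avoid `v`. A face of `K` above `σ` is also
  -- to be removed, and so is its erasure of `v`, which by maximality equals `σ`. Hence `σ` is a
  -- free face of `insert v σ`.
  obtain ⟨σ, -, hσ⟩ := Finset.exists_le_maximal _ hτe
  have hσm := hσ.prop
  simp only [Finset.mem_filter, Finset.mem_univ, true_and] at hσm
  obtain ⟨hvσ, hσK, hσL⟩ := hσm
  have hfree : ∀ ρ ∈ K, σ ⊆ ρ → ρ = σ ∨ ρ = insert v σ := by
    intro ρ hρ hsub
    have hρL : ρ ∉ L := fun h => hσL (L.lower hsub h)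
    have h1 : σ ⊆ ρ.erase v := fun u hu =>
      Finset.mem_erase.2 ⟨fun h => hvσ (h ▸ hu), hsub hu⟩
    have h2 : ρ.erase v = σ := by
      refine (hσ.eq_of_le ?_ h1).symm
      simp only [Finset.mem_filter, Finset.mem_univ, true_and]
      exact ⟨by simp, K.lower (Finset.erase_subset _ _) hρ, (htog ρ hρ hρL).2⟩
    by_cases hvρ : v ∈ ρ
    · right; rw [← h2, Finset.insert_erase hvρ]
    · left; rw [← h2, Finset.erase_eq_of_notMem hvρ]
  let K' : LowerSet (Finset V) :=
    ⟨{ρ | ρ ∈ K ∧ ¬ σ ⊆ ρ}, fun a b hba ha => ⟨K.lower hba ha.1, fun h => ha.2 (h.trans hba)⟩⟩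
  have hK' : ∀ ρ, ρ ∈ K' ↔ ρ ∈ K ∧ ¬ σ ⊆ ρ := fun ρ => Iff.rfl
  have hne : σ.Nonempty := by
    rw [Finset.nonempty_iff_ne_empty]; rintro rfl; exact hσL hbot
  obtain ⟨e⟩ := elementary_collapse hne hvσ (htog σ hσK hσL).1 hfree hK'
  have hLK' : L ≤ K' := fun ρ hρ => ⟨hLK hρ, fun h => hσL (L.lower h hρ)⟩
  obtain ⟨e'⟩ := ih _ (by
    rw [← hN]
    apply Finset.card_lt_card
    refine Finset.ssubset_iff_of_subset ?_ |>.2 ⟨σ, ?_, ?_⟩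
    · intro ρ; simp only [Finset.mem_filter, Finset.mem_univ, true_and, hK']; tauto
    · simp [hσK, hσL]
    · simp [hK']) hLK' (by
    intro ρ hρ hρL
    refine ⟨⟨(htog ρ hρ.1 hρL).1, fun h => hρ.2 ?_⟩, (htog ρ hρ.1 hρL).2⟩
    intro u hu
    rcases Finset.mem_insert.1 (h hu) with h' | h'
    · exact absurd (h' ▸ hu) hvσ
    · exact h') rfl
  exact ⟨e.trans e'⟩

end Collapse

/-! ### Maps between wedges -/

section WedgeMaps

variable {ι : Type*} {X Y : ι → Type*}

/-- The inclusion of a summand into a wedge. -/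
def Wedge.incl (p : ∀ i, X i) (i : ι) (a : X i) : Wedge p := Quot.mk _ (Sum.inr ⟨i, a⟩)

/-- The base point of a wedge. -/
def Wedge.base (p : ∀ i, X i) : Wedge p := Quot.mk _ (Sum.inl ())

theorem Wedge.incl_base (p : ∀ i, X i) (i : ι) : Wedge.incl p i (p i) = Wedge.base p :=
  (Quot.sound (WedgeRel.base i)).symm

theorem Wedge.ind {p : ∀ i, X i} {P : Wedge p → Prop} (h0 : P (Wedge.base p))
    (h : ∀ i a, P (Wedge.incl p i a)) (w : Wedge p) : P w := by
  rcases w with ⟨⟨⟩ | ⟨i, a⟩⟩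
  · exact h0
  · exact h i a

/-- The map out of a wedge given by maps out of the summands that send the base points to a common
point. -/
def Wedge.lift {T : Type*} {p : ∀ i, X i} (t : T) (f : ∀ i, X i → T) (h : ∀ i, f i (p i) = t) :
    Wedge p → T :=
  Quot.lift (Sum.elim (fun _ => t) fun x => f x.1 x.2) (by
    rintro _ _ ⟨i⟩
    exact (h i).symm)

variable [∀ i, TopologicalSpace (X i)] [∀ i, TopologicalSpace (Y i)]

theorem Wedge.continuous_incl (p : ∀ i, X i) (i : ι) : Continuous (Wedge.incl p i) :=
  continuous_quot_mk.comp (continuous_inr.comp continuous_sigmaMk)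

theorem Wedge.continuous_lift {T : Type*} [TopologicalSpace T] {p : ∀ i, X i} {t : T}
    {f : ∀ i, X i → T} {h : ∀ i, f i (p i) = t} (hf : ∀ i, Continuous (f i)) :
    Continuous (Wedge.lift t f h) :=
  continuous_quot_lift _ (continuous_const.sumElim (continuous_sigma hf))

/-- The map of wedges induced by a family of maps preserving the base points. -/
def Wedge.map {p : ∀ i, X i} {q : ∀ i, Y i} (f : ∀ i, C(X i, Y i)) (h : ∀ i, f i (p i) = q i) :
    C(Wedge p, Wedge q) :=
  ⟨Wedge.lift (Wedge.base q) (fun i a => Wedge.incl q i (f i a))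
    (fun i => by rw [h, Wedge.incl_base]),
    Wedge.continuous_lift fun i => (Wedge.continuous_incl q i).comp (f i).continuous⟩

/-- Homotopies of the summands relative to the base points induce a homotopy of the wedges. -/
theorem Wedge.homotopic_map {p : ∀ i, X i} {q : ∀ i, Y i} (f g : ∀ i, C(X i, Y i))
    (hf : ∀ i, f i (p i) = q i) (hg : ∀ i, g i (p i) = q i)
    (h : ∀ i, (f i).HomotopicRel (g i) {p i}) :
    (Wedge.map f hf).Homotopic (Wedge.map g hg) := by
  let F := fun i => Classical.choice (h i)
  -- The homotopy is curried into a map from the wedge to a path space, so continuity comes from the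
  -- quotient topology of the wedge alone, not of its product with the interval.
  let G : ∀ i, X i → C(unitInterval, Wedge q) := fun i a =>
    ⟨fun t => Wedge.incl q i (F i (t, a)), (Wedge.continuous_incl q i).comp (by fun_prop)⟩
  have hG : ∀ i, G i (p i) = ContinuousMap.const _ (Wedge.base q) := by
    intro i
    ext t
    change Wedge.incl q i (F i (t, p i)) = Wedge.base q
    rw [(F i).eq_fst t rfl, hf, Wedge.incl_base]
  have hGc : ∀ i, Continuous (G i) := fun i =>
    ContinuousMap.continuous_of_continuous_uncurry _
      ((Wedge.continuous_incl q i).comp (by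
        change Continuous fun x : X i × unitInterval => F i (x.2, x.1)
        fun_prop))
  let H : C(Wedge p, C(unitInterval, Wedge q)) :=
    ⟨Wedge.lift _ G hG, Wedge.continuous_lift hGc⟩
  refine ⟨⟨(ContinuousMap.uncurry H).comp ⟨Prod.swap, continuous_swap⟩, ?_, ?_⟩⟩
  · refine Wedge.ind rfl fun i a => ?_
    change Wedge.incl q i (F i (0, a)) = Wedge.incl q i (f i a)
    rw [(F i).apply_zero]
  · refine Wedge.ind rfl fun i a => ?_
    change Wedge.incl q i (F i (1, a)) = Wedge.incl q i (g i a)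
    rw [(F i).apply_one]

/-- Wedges of homeomorphic pointed spaces are homotopy equivalent. -/
theorem Wedge.homotopyEquiv_of_homeomorph {p : ∀ i, X i} {q : ∀ i, Y i} (e : ∀ i, X i ≃ₜ Y i)
    (h : ∀ i, e i (p i) = q i) : Nonempty (Wedge p ≃ₕ Wedge q) := by
  refine ⟨⟨Wedge.map (fun i => (e i : C(X i, Y i))) h,
    Wedge.map (fun i => ((e i).symm : C(Y i, X i))) fun i => by simp [← h], ?_, ?_⟩⟩
  · convert ContinuousMap.Homotopic.refl _ using 1
    ext w
    revert w
    refine Wedge.ind rfl fun i a => ?_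
    exact congrArg (Wedge.incl p i) ((e i).symm_apply_apply a).symm
  · convert ContinuousMap.Homotopic.refl _ using 1
    ext w
    revert w
    refine Wedge.ind rfl fun i a => ?_
    exact congrArg (Wedge.incl q i) ((e i).apply_symm_apply a).symm

end WedgeMaps

/-! ### The boundary of a simplex -/

section SimplexBoundary

/-- The standard solid simplex with the origin as a vertex. -/
def cornerSimplex (ι : Type*) [Fintype ι] : Set (EuclideanSpace ℝ ι) :=
  {y | (∀ a, 0 ≤ y a) ∧ ∑ a, y a ≤ 1}

variable {ι : Type*} [Fintype ι]

theorem interior_cornerSimplex [DecidableEq ι] :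
    interior (cornerSimplex ι) = {y | (∀ a, 0 < y a) ∧ ∑ a, y a < 1} := by
  apply Set.Subset.antisymm
  · intro y hy
    have hys := interior_subset hy
    rw [mem_interior_iff_mem_nhds] at hy
    -- An interior point can be moved a little in every direction; moving along `-e_a` and `e_a`
    -- makes the defining inequalities strict.
    have key : ∀ z : EuclideanSpace ℝ ι, ∃ ε : ℝ, 0 < ε ∧ y + ε • z ∈ cornerSimplex ι := by
      intro z
      have hc : Filter.Tendsto (fun ε : ℝ => y + ε • z) (nhdsWithin 0 (Set.Ioi 0)) (nhds y) := by
        have : Continuous fun ε : ℝ => y + ε • z := by fun_prop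
        simpa using (this.tendsto 0).mono_left nhdsWithin_le_nhds
      obtain ⟨ε, h1, h2⟩ := ((hc.eventually hy).and self_mem_nhdsWithin).exists
      exact ⟨ε, h2, h1⟩
    have hpos : ∀ a, 0 < y a := by
      intro a
      obtain ⟨ε, hε, h⟩ := key (EuclideanSpace.single a (-1))
      have := h.1 a
      simp at this
      linarith
    refine ⟨hpos, ?_⟩
    rcases isEmpty_or_nonempty ι with hι | ⟨⟨a⟩⟩
    · simp
    · obtain ⟨ε, hε, h⟩ := key (EuclideanSpace.single a 1)
      have := h.2
      simp [Finset.sum_add_distrib] at this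
      linarith
  · apply interior_maximal
    · exact fun y hy => ⟨fun a => (hy.1 a).le, hy.2.le⟩
    · have h1 : IsOpen (⋂ a, {y : EuclideanSpace ℝ ι | 0 < y a}) :=
        isOpen_iInter_of_finite fun a =>
          isOpen_lt continuous_const (EuclideanSpace.proj (𝕜 := ℝ) a).continuous
      have h2 : IsOpen {y : EuclideanSpace ℝ ι | ∑ a, y a < 1} :=
        isOpen_lt (continuous_finsetSum _ fun a _ =>
          (EuclideanSpace.proj (𝕜 := ℝ) a).continuous) continuous_const
      convert h1.inter h2 using 1
      ext y
      simp

theorem isClosed_cornerSimplex : IsClosed (cornerSimplex ι) := by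
  have h1 : IsClosed (⋂ a, {y : EuclideanSpace ℝ ι | 0 ≤ y a}) :=
    isClosed_iInter fun a =>
      isClosed_le continuous_const (EuclideanSpace.proj (𝕜 := ℝ) a).continuous
  have h2 : IsClosed {y : EuclideanSpace ℝ ι | ∑ a, y a ≤ 1} :=
    isClosed_le (continuous_finsetSum _ fun a _ =>
      (EuclideanSpace.proj (𝕜 := ℝ) a).continuous) continuous_const
  convert h1.inter h2 using 1
  ext y
  simp [cornerSimplex]

theorem frontier_cornerSimplex :
    frontier (cornerSimplex ι) =
      {y ∈ cornerSimplex ι | (∃ a, y a = 0) ∨ ∑ a, y a = 1} := by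
  classical
  rw [isClosed_cornerSimplex.frontier_eq, interior_cornerSimplex]
  ext y
  simp only [Set.mem_sdiff, Set.mem_ofPred_eq, not_and_or, not_forall, not_lt]
  refine and_congr_right fun hy => or_congr (exists_congr fun a => ?_) ?_
  · exact ⟨fun h => le_antisymm h (hy.1 a), fun h => h.le⟩
  · exact ⟨fun h => le_antisymm hy.2 h, fun h => h.ge⟩

theorem convex_cornerSimplex : Convex ℝ (cornerSimplex ι) := by
  intro y hy z hz a b ha hb hab
  refine ⟨fun i => ?_, ?_⟩
  · have := hy.1 i
    have := hz.1 i
    simp only [PiLp.add_apply, PiLp.smul_apply, smul_eq_mul]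
    positivity
  · simp only [PiLp.add_apply, PiLp.smul_apply, smul_eq_mul, Finset.sum_add_distrib,
      ← Finset.mul_sum]
    nlinarith [hy.2, hz.2]

theorem isBounded_cornerSimplex : Bornology.IsBounded (cornerSimplex ι) := by
  rw [isBounded_iff_forall_norm_le]
  refine ⟨Real.sqrt (Fintype.card ι), fun y hy => ?_⟩
  rw [EuclideanSpace.norm_eq]
  apply Real.sqrt_le_sqrt
  have : ∀ a ∈ Finset.univ, ‖y a‖ ^ 2 ≤ 1 := by
    intro a ha
    have h0 := hy.1 a
    have h1 : y a ≤ 1 :=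
      (Finset.single_le_sum (f := fun a => y a) (fun b _ => hy.1 b) ha).trans hy.2
    rw [Real.norm_of_nonneg h0]
    nlinarith
  calc _ ≤ ∑ a : ι, (1 : ℝ) := Finset.sum_le_sum this
    _ = _ := by simp

theorem nonempty_interior_cornerSimplex : (interior (cornerSimplex ι)).Nonempty := by
  classical
  rw [interior_cornerSimplex]
  refine ⟨WithLp.toLp 2 fun _ => 1 / (Fintype.card ι + 1), fun a => ?_, ?_⟩
  · simp only
    positivity
  · simp only [Finset.sum_const, Finset.card_univ, nsmul_eq_mul, mul_one_div]
    rw [div_lt_one (by positivity)]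
    linarith

/-- The boundary of the standard solid simplex is a sphere, in such a way that a given point
corresponds to a given point. -/
theorem exists_homeomorph_frontier_cornerSimplex (y : frontier (cornerSimplex ι))
    (b : Metric.sphere (0 : EuclideanSpace ℝ ι) 1) :
    ∃ e : frontier (cornerSimplex ι) ≃ₜ Metric.sphere (0 : EuclideanSpace ℝ ι) 1, e y = b := by
  obtain ⟨h, -, -, h3⟩ := exists_homeomorph_image_interior_closure_frontier_eq_unitBall
    (convex_cornerSimplex (ι := ι)) nonempty_interior_cornerSimplex isBounded_cornerSimplex
  let e₁ := (h.image (frontier (cornerSimplex ι))).trans (Homeomorph.setCongr h3)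
  let v : EuclideanSpace ℝ ι := e₁ y
  -- The reflection in the hyperplane orthogonal to `v - b` preserves the sphere and carries `v` to
  -- `b`, since both have norm one.
  let ρ : EuclideanSpace ℝ ι ≃ₜ EuclideanSpace ℝ ι :=
    (Submodule.reflection (ℝ ∙ (v - b))ᗮ).toHomeomorph
  have hρv : ρ v = b := by
    apply Submodule.reflection_sub
    have h1 : ‖v‖ = 1 := mem_sphere_zero_iff_norm.1 (e₁ y).2
    have h2 : ‖(b : EuclideanSpace ℝ ι)‖ = 1 := mem_sphere_zero_iff_norm.1 b.2
    rw [h1, h2]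
  have hρ : ρ '' Metric.sphere 0 1 = Metric.sphere 0 1 := by
    have := (Submodule.reflection (ℝ ∙ (v - b))ᗮ).image_sphere 0 1
    rwa [map_zero] at this
  refine ⟨e₁.trans ((ρ.image _).trans (Homeomorph.setCongr hρ)), ?_⟩
  exact Subtype.ext hρv

variable {V : Type*} [Fintype V] [DecidableEq V]

/-- The boundary of the simplex with vertex set `insert x T`. -/
def simplexBoundary (x : V) (T : Finset V) : Set (V → ℝ) :=
  {p | p ∈ stdSimplex ℝ V ∧ (∀ u, p u ≠ 0 → u ∈ insert x T) ∧ ∃ u ∈ insert x T, p u = 0}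

theorem single_mem_simplexBoundary (x : V) {T : Finset V} (hT : T.Nonempty) (hx : x ∉ T) :
    Pi.single x 1 ∈ simplexBoundary x T := by
  refine ⟨single_mem_stdSimplex ℝ x, fun u hu => ?_, ?_⟩
  · by_contra h
    apply hu
    rw [Pi.single_eq_of_ne]
    rintro rfl
    simp at h
  · obtain ⟨u, hu⟩ := hT
    refine ⟨u, Finset.mem_insert_of_mem hu, Pi.single_eq_of_ne ?_ _⟩
    rintro rfl
    exact hx hu

/-- The boundary of an abstract simplex is homeomorphic to the boundary of the standard solid
simplex. -/
theorem exists_homeomorph_simplexBoundary (x : V) {T : Finset V} (hx : x ∉ T) (ε : ι ≃ T) :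
    ∃ e : simplexBoundary x T ≃ₜ frontier (cornerSimplex ι),
      ∀ p a, (e p : EuclideanSpace ℝ ι) a = (p : V → ℝ) (ε a) := by
  have hsum : ∀ f : V → ℝ, ∑ a, f (ε a) = ∑ u ∈ T, f u := by
    intro f
    rw [ε.sum_comp (fun u : T => f u), Finset.sum_coe_sort]
  have hsumx : ∀ p ∈ simplexBoundary x T, p x + ∑ u ∈ T, p u = 1 := by
    intro p hp
    rw [← Finset.sum_insert hx, ← hp.1.2]
    apply Finset.sum_subset (Finset.subset_univ _)
    intro u _ hu
    by_contra h
    exact hu (hp.2.1 u h)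
  have hto : ∀ p ∈ simplexBoundary x T,
      (WithLp.toLp 2 fun a => p (ε a)) ∈ frontier (cornerSimplex ι) := by
    intro p hp
    have h1 := hsumx p hp
    rw [frontier_cornerSimplex]
    refine ⟨⟨fun a => hp.1.1 _, ?_⟩, ?_⟩
    · simp only [hsum]
      linarith [hp.1.1 x]
    · obtain ⟨u, hu, hu0⟩ := hp.2.2
      rcases Finset.mem_insert.1 hu with rfl | hu
      · right
        simp only [hsum]
        linarith
      · left
        exact ⟨ε.symm ⟨u, hu⟩, by simpa using hu0⟩
  -- The homeomorphism forgets the coordinate at `x`, which is recovered as one minus the sum of the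
  -- others; the facet opposite `x` becomes the facet of coordinate sum one.
  let inv : EuclideanSpace ℝ ι → V → ℝ := fun y u =>
    if h : u ∈ T then y (ε.symm ⟨u, h⟩) else if u = x then 1 - ∑ a, y a else 0
  have hinvT : ∀ y u (h : u ∈ T), inv y u = y (ε.symm ⟨u, h⟩) := fun y u h => by
    simp only [inv, h, dif_pos]
  have hinvx : ∀ y, inv y x = 1 - ∑ a, y a := fun y => by simp [inv, hx]
  have hinv0 : ∀ y u, u ∉ insert x T → inv y u = 0 := fun y u h => by
    rw [Finset.mem_insert, not_or] at h
    simp [inv, h.1, h.2]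
  have hinv : ∀ y ∈ frontier (cornerSimplex ι), inv y ∈ simplexBoundary x T := by
    intro y hy
    rw [frontier_cornerSimplex] at hy
    refine ⟨⟨fun u => ?_, ?_⟩, fun u hu => ?_, ?_⟩
    · by_cases h : u ∈ T
      · rw [hinvT y u h]; exact hy.1.1 _
      · by_cases h' : u = x
        · rw [h', hinvx]; linarith [hy.1.2]
        · exact (hinv0 y u (by simp [h, h'])).ge
    · rw [← Finset.sum_subset (Finset.subset_univ (insert x T)) fun u _ hu => hinv0 y u hu,
        Finset.sum_insert hx, hinvx, ← hsum]
      simp [hinvT]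
    · by_contra h; exact hu (hinv0 y u h)
    · rcases hy.2 with ⟨a, ha⟩ | h
      · exact ⟨ε a, Finset.mem_insert_of_mem (ε a).2, by rw [hinvT y _ (ε a).2]; simpa using ha⟩
      · exact ⟨x, Finset.mem_insert_self _ _, by rw [hinvx, h, sub_self]⟩
  refine ⟨⟨⟨fun p => ⟨_, hto p p.2⟩, fun y => ⟨_, hinv y y.2⟩, ?_, ?_⟩, ?_, ?_⟩, fun p a => rfl⟩
  · rintro ⟨p, hp⟩
    ext u
    change inv _ u = p u
    by_cases h : u ∈ T
    · rw [hinvT _ u h]; simp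
    · by_cases h' : u = x
      · rw [h', hinvx]
        simp only [hsum]
        linarith [hsumx p hp]
      · rw [hinv0 _ u (by simp [h, h'])]
        by_contra h0
        have := hp.2.1 u (Ne.symm h0)
        simp [h, h'] at this
  · rintro ⟨y, hy⟩
    ext a
    change inv y (ε a) = y a
    rw [hinvT y _ (ε a).2]
    simp
  · apply Continuous.subtype_mk
    exact (PiLp.continuous_toLp 2 _).comp
      (continuous_pi fun a => (continuous_apply _).comp continuous_subtype_val)
  · apply Continuous.subtype_mk
    refine continuous_pi fun u => ?_
    change Continuous fun y : frontier (cornerSimplex ι) => inv y u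
    by_cases h : u ∈ T
    · simp only [hinvT _ u h]
      fun_prop
    · by_cases h' : u = x
      · simp only [h', hinvx]
        fun_prop
      · simp only [hinv0 _ u (by simp [h, h'])]
        fun_prop

theorem exists_homeomorph_simplexBoundary_unitSphere (x : V) {T : Finset V} (hx : x ∉ T) {d : ℕ}
    (hT : T.card = d + 1) (p : simplexBoundary x T) :
    ∃ e : simplexBoundary x T ≃ₜ UnitSphere d, e p = UnitSphere.basePoint d := by
  obtain ⟨e₁, -⟩ := exists_homeomorph_simplexBoundary x hx (T.equivFinOfCardEq hT).symm
  obtain ⟨e₂, he₂⟩ := exists_homeomorph_frontier_cornerSimplex (e₁ p) (UnitSphere.basePoint d)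
  exact ⟨e₁.trans e₂, he₂⟩

end SimplexBoundary

/-! ### Attaching simplices to a cone -/

section ConeWithSimplices

variable {V : Type*} {T : Finset V} (hT : T.Nonempty)

/-- The least coordinate on `T`, truncated at half of its value at the barycenter of `T`. -/
noncomputable def coreWeight (p : V → ℝ) : ℝ := min (T.inf' hT p) (1 / (2 * T.card))

theorem continuous_coreWeight : Continuous (coreWeight hT) :=
  (continuous_inf' hT).min continuous_const

theorem coreWeight_le {p : V → ℝ} {u : V} (hu : u ∈ T) : coreWeight hT p ≤ p u :=
  (min_le_left _ _).trans (Finset.inf'_le _ hu)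

theorem two_card_pos {V : Type*} {T : Finset V} (hT : T.Nonempty) : (0 : ℝ) < 2 * T.card := by
  have : 0 < T.card := hT.card_pos
  positivity

/-- Because of the truncation, `2 * T.card * coreWeight` can serve as an interpolation parameter in
`coneExpand`, and the denominator of `radialExpand` is at least one half. -/
theorem two_card_mul_coreWeight_le (p : V → ℝ) : 2 * T.card * coreWeight hT p ≤ 1 := by
  have h := min_le_right (T.inf' hT p) (1 / (2 * T.card : ℝ))
  rw [le_div_iff₀ (two_card_pos hT)] at h
  unfold coreWeight
  linarith

theorem one_sub_card_mul_coreWeight_pos (p : V → ℝ) : 0 < 1 - T.card * coreWeight hT p := by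
  linarith [two_card_mul_coreWeight_le hT p]

/-- Below the truncation value the weight is the true minimum over `T`, which is attained. The
radial expansion kills that coordinate and so lands in the boundary of `T`. -/
theorem exists_eq_coreWeight {p : V → ℝ} (h : 2 * T.card * coreWeight hT p ≠ 1) :
    ∃ u ∈ T, p u = coreWeight hT p := by
  obtain ⟨u, hu, h'⟩ := Finset.exists_mem_eq_inf' hT p
  refine ⟨u, hu, ?_⟩
  rcases min_choice (T.inf' hT p) (1 / (2 * T.card : ℝ)) with h1 | h1
  · rw [← h']; exact h1.symm
  · exfalso
    apply h
    have := (two_card_pos hT).ne'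
    unfold coreWeight
    rw [h1]
    field_simp

theorem coreWeight_nonneg [Fintype V] {p : V → ℝ} (hp : p ∈ stdSimplex ℝ V) : 0 ≤ coreWeight hT p :=
  le_min (inf'_nonneg_of_stdSimplex hT hp) (by positivity)

theorem apply_ne_zero_of_coreWeight_ne_zero [Fintype V] {p : V → ℝ} (hp : p ∈ stdSimplex ℝ V)
    (h : coreWeight hT p ≠ 0) {u : V} (hu : u ∈ T) : p u ≠ 0 := fun h0 =>
  h (le_antisymm (h0 ▸ coreWeight_le hT hu) (coreWeight_nonneg hT hp))

variable [DecidableEq V]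

/-- Radial expansion of the simplex `T` from its barycenter, by the factor two near the
barycenter and up to the boundary elsewhere. -/
noncomputable def radialExpand (p : V → ℝ) : V → ℝ :=
  fun u => (p u - if u ∈ T then coreWeight hT p else 0) / (1 - T.card * coreWeight hT p)

/-- Radial expansion of the simplex `T` into the boundary of the cone over it with apex `x`. -/
noncomputable def coneExpand (x : V) (p : V → ℝ) : V → ℝ :=
  (1 - 2 * T.card * coreWeight hT p) • Pi.single x 1 +
    (2 * T.card * coreWeight hT p) • radialExpand hT p

theorem continuous_radialExpand : Continuous (radialExpand hT) := by
  have h := continuous_coreWeight hT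
  refine continuous_pi fun u => ?_
  refine Continuous.div ?_ (by fun_prop) fun p => (one_sub_card_mul_coreWeight_pos hT p).ne'
  split_ifs <;> fun_prop

theorem continuous_coneExpand (x : V) : Continuous (coneExpand hT x) := by
  have h := continuous_coreWeight hT
  have h' := continuous_radialExpand hT
  unfold coneExpand
  fun_prop

theorem radialExpand_of_eq_zero {p : V → ℝ} (h : coreWeight hT p = 0) : radialExpand hT p = p := by
  ext u
  simp [radialExpand, h]

theorem coneExpand_of_eq_zero (x : V) {p : V → ℝ} (h : coreWeight hT p = 0) :
    coneExpand hT x p = Pi.single x 1 := by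
  simp [coneExpand, h]

theorem coneExpand_of_eq_one (x : V) {p : V → ℝ} (h : 2 * T.card * coreWeight hT p = 1) :
    coneExpand hT x p = radialExpand hT p := by
  simp [coneExpand, h]

theorem exists_radialExpand_eq_zero {p : V → ℝ} (h : 2 * T.card * coreWeight hT p ≠ 1) :
    ∃ u ∈ T, radialExpand hT p u = 0 := by
  obtain ⟨u, hu, h'⟩ := exists_eq_coreWeight hT h
  exact ⟨u, hu, by simp [radialExpand, hu, h']⟩

theorem coneExpand_apply_eq_zero {x u : V} {p : V → ℝ} (hu : u ≠ x)
    (h : radialExpand hT p u = 0) : coneExpand hT x p u = 0 := by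
  simp [coneExpand, h, hu]

variable [Fintype V]

theorem radialExpand_mem {p : V → ℝ} (hp : p ∈ stdSimplex ℝ V) :
    radialExpand hT p ∈ stdSimplex ℝ V := by
  have h1 := one_sub_card_mul_coreWeight_pos hT p
  constructor
  · intro u
    apply div_nonneg _ h1.le
    split_ifs with hu
    · linarith [coreWeight_le hT (p := p) hu]
    · linarith [hp.1 u]
  · unfold radialExpand
    rw [← Finset.sum_div, Finset.sum_sub_distrib, hp.2, div_eq_one_iff_eq h1.ne']
    simp

theorem radialExpand_apply_eq_zero {p : V → ℝ} (hp : p ∈ stdSimplex ℝ V) {u : V} (hu : p u = 0) :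
    radialExpand hT p u = 0 := by
  unfold radialExpand
  rw [hu]
  split_ifs with h
  · have h1 := coreWeight_le hT (p := p) h
    have h2 := coreWeight_nonneg hT hp
    rw [show coreWeight hT p = 0 by linarith]
    simp
  · simp

theorem coneExpand_mem (x : V) {p : V → ℝ} (hp : p ∈ stdSimplex ℝ V) :
    coneExpand hT x p ∈ stdSimplex ℝ V := by
  refine convex_stdSimplex ℝ V (single_mem_stdSimplex ℝ x) (radialExpand_mem hT hp)
    (by linarith [two_card_mul_coreWeight_le hT p]) ?_ (by ring)
  have := coreWeight_nonneg hT hp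
  positivity

/-- Weight zero gives the apex, the truncated region gives the facet `T` opposite `x`, and the
region between them gives segments from `x` to boundary points of `T`. The hypothesis `h` comes from
maximality of `T` in the complex. -/
theorem coneExpand_mem_simplexBoundary {x : V} (hx : x ∉ T) {p : V → ℝ}
    (hp : p ∈ stdSimplex ℝ V) (h : coreWeight hT p ≠ 0 → ∀ u, p u ≠ 0 → u ∈ T) :
    coneExpand hT x p ∈ simplexBoundary x T := by
  by_cases h0 : coreWeight hT p = 0
  · rw [coneExpand_of_eq_zero hT x h0]
    exact single_mem_simplexBoundary x hT hx
  have hs := h h0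
  have hz : ∀ u, u ∉ T → radialExpand hT p u = 0 := fun u hu =>
    radialExpand_apply_eq_zero hT hp (by by_contra h; exact hu (hs u h))
  refine ⟨coneExpand_mem hT x hp, fun u hu => ?_, ?_⟩
  · by_contra hn
    rw [Finset.mem_insert, not_or] at hn
    exact hu (coneExpand_apply_eq_zero hT hn.1 (hz u hn.2))
  · by_cases h1 : 2 * T.card * coreWeight hT p = 1
    · rw [coneExpand_of_eq_one hT x h1]
      exact ⟨x, Finset.mem_insert_self _ _, hz x hx⟩
    · obtain ⟨u, hu, h⟩ := exists_radialExpand_eq_zero hT h1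
      exact ⟨u, Finset.mem_insert_of_mem hu,
        coneExpand_apply_eq_zero hT (fun h => hx (h ▸ hu)) h⟩

theorem segment_mem_simplexBoundary {x : V} {p q : V → ℝ} (hp : p ∈ simplexBoundary x T)
    (hq : q ∈ simplexBoundary x T) {u : V} (hu : u ∈ insert x T) (hpu : p u = 0) (hqu : q u = 0)
    {t : ℝ} (h0 : 0 ≤ t) (h1 : t ≤ 1) : (1 - t) • p + t • q ∈ simplexBoundary x T := by
  refine ⟨convex_stdSimplex ℝ V hp.1 hq.1 (by linarith) h0 (by ring), fun v hv => ?_, u, hu, ?_⟩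
  · by_contra hvσ
    have e1 : p v = 0 := by by_contra h; exact hvσ (hp.2.1 v h)
    have e2 : q v = 0 := by by_contra h; exact hvσ (hq.2.1 v h)
    simp [e1, e2] at hv
  · simp [hpu, hqu]

/-- The radial expansion maps the boundary of the cone over the simplex `T` to itself, by a map
homotopic to the identity relative to the apex. -/
theorem coneExpand_homotopicRel_id {x : V} (hx : x ∉ T)
    (Q : C(simplexBoundary x T, simplexBoundary x T))
    (hQ : ∀ p, (Q p : V → ℝ) = coneExpand hT x p) (b : simplexBoundary x T)
    (hb : (b : V → ℝ) = Pi.single x 1) : Q.HomotopicRel (.id _) {b} := by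
  have hR : ∀ p ∈ simplexBoundary x T, radialExpand hT p ∈ simplexBoundary x T := by
    intro p hp
    refine ⟨radialExpand_mem hT hp.1, fun u hu => hp.2.1 u fun h =>
      hu (radialExpand_apply_eq_zero hT hp.1 h), ?_⟩
    obtain ⟨u, hu, h⟩ := hp.2.2
    exact ⟨u, hu, radialExpand_apply_eq_zero hT hp.1 h⟩
  let R : C(simplexBoundary x T, simplexBoundary x T) :=
    ⟨fun p => ⟨_, hR p p.2⟩,
      ((continuous_radialExpand hT).comp continuous_subtype_val).subtype_mk _⟩
  have hb0 : coreWeight hT (b : V → ℝ) = 0 := by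
    by_contra h
    obtain ⟨u, hu⟩ := hT
    apply apply_ne_zero_of_coreWeight_ne_zero _ b.2.1 h hu
    rw [hb, Pi.single_eq_of_ne]
    rintro rfl
    exact hx hu
  -- Either the two maps agree at `p`, or some coordinate in `T` vanishes in both images, so the
  -- segment stays in the boundary.
  have h1 : Q.HomotopicRel R {b} := by
    apply homotopicRel_of_segment
    · rintro _ rfl
      refine Subtype.ext ?_
      rw [hQ, coneExpand_of_eq_zero hT x hb0, ← hb]
      exact (radialExpand_of_eq_zero hT hb0).symm
    · intro p t h0 h1
      change (1 - t) • (Q p : V → ℝ) + t • (radialExpand hT p : V → ℝ) ∈ _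
      by_cases h : 2 * T.card * coreWeight hT (p : V → ℝ) = 1
      · rw [hQ, coneExpand_of_eq_one hT x h, ← add_smul, sub_add_cancel, one_smul]
        exact hR p p.2
      · obtain ⟨u, hu, hu0⟩ := exists_radialExpand_eq_zero hT h
        refine segment_mem_simplexBoundary (Q p).2 (hR p p.2) (Finset.mem_insert_of_mem hu) ?_ hu0
          h0 h1
        rw [hQ]
        exact coneExpand_apply_eq_zero hT (fun h => hx (h ▸ hu)) hu0
  refine h1.trans ?_
  apply homotopicRel_of_segment
  · rintro _ rfl
    exact Subtype.ext (radialExpand_of_eq_zero hT hb0)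
  · intro p t h0 h1
    obtain ⟨u, hu, hu0⟩ := p.2.2.2
    exact segment_mem_simplexBoundary (hR p p.2) p.2 hu (radialExpand_apply_eq_zero hT p.2.1 hu0)
      hu0 h0 h1

/-- A cone with apex `x`, to which simplices of dimension `d` are attached along their boundaries,
is homotopy equivalent to a wedge of spheres of dimension `d`. -/
theorem homotopyEquiv_wedgeOfSpheres {K : LowerSet (Finset V)} (x : V) {r d : ℕ} (hr : r ≠ 0)
    (C : Fin r → Finset V) (hinj : Function.Injective C) (hC : ∀ i, C i ∈ K)
    (hmax : ∀ i, ∀ σ ∈ K, C i ⊆ σ → σ = C i) (hcard : ∀ i, (C i).card = d + 1)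
    (hx : ∀ i, x ∉ C i) (hcone : ∀ σ ∈ K, (∃ i, σ = C i) ∨ insert x σ ∈ K) :
    Nonempty (geometricRealization K ≃ₕ WedgeOfSpheres r d) := by
  have hne : ∀ i, (C i).Nonempty := fun i => Finset.card_pos.1 (by rw [hcard]; omega)
  let φ : Fin r → (V → ℝ) → ℝ := fun i => coreWeight (hne i)
  let b : ∀ i, simplexBoundary x (C i) :=
    fun i => ⟨Pi.single x 1, single_mem_simplexBoundary x (hne i) (hx i)⟩
  -- By maximality a facet of `C i` is not one of the `C j`, so its cone lies in `K`: the attaching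
  -- boundaries are inside the cone.
  have herase : ∀ i, ∀ w ∈ C i, insert x ((C i).erase w) ∈ K := by
    intro i w hw
    refine (hcone _ (K.lower (Finset.erase_subset w _) (hC i))).resolve_left ?_
    rintro ⟨j, hj⟩
    have h1 : C j ⊆ C i := hj ▸ Finset.erase_subset w _
    rw [← hmax j _ (hC i) h1] at hj
    exact Finset.notMem_erase w (C i) (by rwa [hj])
  have hsub : ∀ i, simplexBoundary x (C i) ⊆ geometricRealization K := by
    rintro i p ⟨hp, hs, u, hu, hu0⟩
    refine ⟨hp, ?_⟩
    rcases Finset.mem_insert.1 hu with rfl | hu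
    · refine ⟨C i, hC i, fun v hv => (Finset.mem_insert.1 (hs v hv)).resolve_left ?_⟩
      rintro rfl
      exact hv hu0
    · refine ⟨_, herase i u hu, fun v hv => ?_⟩
      have hvu : v ≠ u := fun h => hv (h ▸ hu0)
      simpa [hvu] using hs v hv
  have hsupp : ∀ i, ∀ p ∈ geometricRealization K, φ i p ≠ 0 → ∀ u, p u ≠ 0 → u ∈ C i := by
    rintro i p ⟨hp, σ, hσ, hs⟩ h u hu
    rw [← hmax i σ hσ fun v hv => hs v (apply_ne_zero_of_coreWeight_ne_zero (hne i) hp h hv)]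
    exact hs u hu
  have huniq : ∀ i, ∀ p ∈ geometricRealization K, φ i p ≠ 0 → ∀ j, j ≠ i → φ j p = 0 := by
    intro i p hp h j hj
    by_contra hj0
    apply hj
    apply hinj
    exact (hmax j _ (hC i) fun v hv => hsupp i p hp h v
      (apply_ne_zero_of_coreWeight_ne_zero (hne j) hp.1 hj0 hv)).symm
  let Q : ∀ i, C(geometricRealization K, simplexBoundary x (C i)) := fun i =>
    ⟨fun p => ⟨_, coneExpand_mem_simplexBoundary (hne i) (hx i) p.2.1 (hsupp i p p.2)⟩,
      ((continuous_coneExpand (hne i) x).comp continuous_subtype_val).subtype_mk _⟩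
  have hQb : ∀ i (p : geometricRealization K), φ i p = 0 → Q i p = b i := fun i p h =>
    Subtype.ext (coneExpand_of_eq_zero (hne i) x h)
  -- The weights `φ i` are nonzero only on the open simplices `C i`, which are disjoint. The value
  -- is specified for every `i` such that the other weights vanish: these conditions define a finite
  -- closed cover, on each member of which the map has a continuous formula.
  have hfex : ∀ p : geometricRealization K, ∃ w : Wedge b,
      ∀ i, (∀ j, j ≠ i → φ j p = 0) → w = Wedge.incl b i (Q i p) := by
    intro p
    by_cases h : ∃ i, φ i p ≠ 0
    · obtain ⟨i, hi⟩ := h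
      refine ⟨Wedge.incl b i (Q i p), fun j hj => ?_⟩
      by_cases hij : i = j
      · rw [hij]
      · exact absurd (hj i hij) hi
    · push Not at h
      refine ⟨Wedge.base b, fun i _ => ?_⟩
      rw [hQb i p (h i), Wedge.incl_base]
  choose f₀ hf₀ using hfex
  have hcover : ∀ p : geometricRealization K, ∃ i, ∀ j, j ≠ i → φ j p = 0 := by
    intro p
    by_cases h : ∃ i, φ i p ≠ 0
    · obtain ⟨i, hi⟩ := h
      exact ⟨i, huniq i p p.2 hi⟩
    · push Not at h
      exact ⟨⟨0, by omega⟩, fun j _ => h j⟩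
  have hφc : ∀ i, Continuous (φ i) := fun i => continuous_coreWeight (hne i)
  have hf₀c : Continuous f₀ := by
    refine (locallyFinite_of_finite fun i : Fin r =>
      {p : geometricRealization K | ∀ j, j ≠ i → φ j p = 0}).continuous ?_ ?_ ?_
    · ext p
      simpa using hcover p
    · intro i
      have : IsClosed (⋂ j, ⋂ _ : j ≠ i, {p : geometricRealization K | φ j p = 0}) :=
        isClosed_iInter fun j => isClosed_iInter fun _ =>
          isClosed_eq ((hφc j).comp continuous_subtype_val) continuous_const
      convert this using 1
      ext p
      simp
    · intro i
      exact (((Wedge.continuous_incl b i).comp (Q i).continuous).continuousOn).congr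
        fun p hp => hf₀ p i hp
  have hxK : Pi.single x 1 ∈ geometricRealization K :=
    hsub ⟨0, by omega⟩ (b ⟨0, by omega⟩).2
  let f : C(geometricRealization K, Wedge b) := ⟨f₀, hf₀c⟩
  let g : C(Wedge b, geometricRealization K) :=
    ⟨Wedge.lift ⟨_, hxK⟩ (fun i => Set.inclusion (hsub i)) fun _ => rfl,
      Wedge.continuous_lift fun i => continuous_inclusion _⟩
  have hfg : (f.comp g).Homotopic (.id _) := by
    let Q' : ∀ i, C(simplexBoundary x (C i), simplexBoundary x (C i)) := fun i =>
      (Q i).comp ⟨Set.inclusion (hsub i), continuous_inclusion _⟩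
    have hrel : ∀ i, (Q' i).HomotopicRel (.id _) {b i} := fun i =>
      coneExpand_homotopicRel_id (hne i) (hx i) _ (fun _ => rfl) _ rfl
    have hQ'b : ∀ i, Q' i (b i) = b i := fun i => by
      obtain ⟨F⟩ := hrel i
      exact F.fst_eq_snd rfl
    have e1 : f.comp g = Wedge.map Q' hQ'b := by
      ext w
      revert w
      refine Wedge.ind ?_ ?_
      · change f₀ ⟨_, hxK⟩ = Wedge.base b
        rw [hf₀ _ ⟨0, by omega⟩, ← Wedge.incl_base b ⟨0, by omega⟩]
        · exact congrArg _ (hQ'b _)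
        · intro j _
          by_contra h
          obtain ⟨u, hu⟩ := hne j
          refine apply_ne_zero_of_coreWeight_ne_zero (hne j) hxK.1 h hu ?_
          rw [Pi.single_eq_of_ne]
          rintro rfl
          exact hx j hu
      · intro i p
        change f₀ (Set.inclusion (hsub i) p) = _
        refine hf₀ _ i fun j hj => ?_
        by_contra h
        apply hj
        apply hinj
        refine (hmax j _ (hC i) fun v hv => ?_).symm
        have hv0 := apply_ne_zero_of_coreWeight_ne_zero (hne j) p.2.1 h hv
        refine (Finset.mem_insert.1 (p.2.2.1 v hv0)).resolve_left ?_
        rintro rfl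
        exact hx j hv
    have e2 : ContinuousMap.id (Wedge b) = Wedge.map (fun i => .id _) fun _ => rfl := by
      ext w
      revert w
      exact Wedge.ind rfl fun _ _ => rfl
    rw [e1, e2]
    exact Wedge.homotopic_map _ _ _ _ hrel
  have hgf : (g.comp f).Homotopic (.id _) := by
    -- On the realization of `K` at most one summand is nonzero, so this single continuous formula
    -- performs the radial expansion in all the `C i` at once.
    let R₀ : (V → ℝ) → V → ℝ := fun p => p + ∑ i, (radialExpand (hne i) p - p)
    have hR₀ : ∀ p ∈ geometricRealization K, ∀ i, (∀ j, j ≠ i → φ j p = 0) →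
        R₀ p = radialExpand (hne i) p := by
      intro p hp i hi
      simp only [R₀]
      rw [Finset.sum_eq_single i]
      · abel
      · intro j _ hj
        rw [radialExpand_of_eq_zero _ (hi j hj), sub_self]
      · simp
    have hR : ∀ p ∈ geometricRealization K, R₀ p ∈ geometricRealization K := by
      intro p hp
      obtain ⟨i, hi⟩ := hcover ⟨p, hp⟩
      rw [hR₀ p hp i hi]
      obtain ⟨hp, σ, hσ, hs⟩ := hp
      exact ⟨radialExpand_mem _ hp, σ, hσ, fun u hu => hs u fun h =>
        hu (radialExpand_apply_eq_zero _ hp h)⟩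
    have hR₀c : Continuous R₀ := by
      have := fun i => continuous_radialExpand (hne i)
      fun_prop
    let R : C(geometricRealization K, geometricRealization K) :=
      ⟨fun p => ⟨_, hR p p.2⟩, (hR₀c.comp continuous_subtype_val).subtype_mk _⟩
    have h1 : (g.comp f).Homotopic R := by
      refine (homotopicRel_of_segment _ _ ∅ (by simp) ?_).homotopic
      rintro ⟨p, hp⟩ t h0 h1
      obtain ⟨i, hi⟩ := hcover ⟨p, hp⟩
      have e : g.comp f ⟨p, hp⟩ = Set.inclusion (hsub i) (Q i ⟨p, hp⟩) := by
        change g (f₀ _) = _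
        rw [hf₀ _ i hi]
        rfl
      rw [e]
      change (1 - t) • coneExpand (hne i) x p + t • R₀ p ∈ _
      rw [hR₀ p hp i hi]
      by_cases h : 2 * (C i).card * coreWeight (hne i) p = 1
      · rw [coneExpand_of_eq_one _ x h, ← add_smul, sub_add_cancel, one_smul, ← hR₀ p hp i hi]
        exact hR p hp
      · obtain ⟨u, hu, hu0⟩ := exists_radialExpand_eq_zero (hne i) h
        -- The segment needs a face containing `x`. If `φ i` vanishes, then `p` lies in a face with
        -- cone in `K`, or in the boundary of some `C j`; otherwise the expansion has lost the
        -- coordinate `u` of `C i`.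
        have key : ∃ σ, insert x σ ∈ K ∧ ∀ v, radialExpand (hne i) p v ≠ 0 → v ∈ σ := by
          by_cases hφ : φ i p = 0
          · rw [radialExpand_of_eq_zero _ hφ]
            obtain ⟨hp', σ, hσ, hs⟩ := hp
            rcases hcone σ hσ with ⟨j, rfl⟩ | h
            · have hj : φ j p = 0 := by
                by_cases hj : j = i
                · rw [hj, hφ]
                · exact hi j hj
              obtain ⟨w, hw, hw0⟩ := exists_eq_coreWeight (hne j) (p := p) (by
                change 2 * (C j).card * φ j p ≠ 1
                simp [hj])
              refine ⟨_, herase j w hw, fun v hv => Finset.mem_erase.2 ⟨?_, hs v hv⟩⟩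
              rintro rfl
              exact hv (hw0.trans hj)
            · exact ⟨σ, h, hs⟩
          · refine ⟨_, herase i u hu, fun v hv => Finset.mem_erase.2 ⟨?_, ?_⟩⟩
            · rintro rfl
              exact hv hu0
            · exact hsupp i p hp hφ v fun h => hv (radialExpand_apply_eq_zero _ hp.1 h)
        obtain ⟨σ, hσ, hs⟩ := key
        refine segment_mem_geometricRealization hσ (coneExpand_mem _ x hp.1)
          (radialExpand_mem _ hp.1) ?_ (fun v hv => Finset.mem_insert_of_mem (hs v hv)) h0 h1
        intro v hv
        by_contra hn
        rw [Finset.mem_insert, not_or] at hn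
        exact hv (coneExpand_apply_eq_zero _ hn.1 (by by_contra h; exact hn.2 (hs v h)))
    refine h1.trans (homotopicRel_of_segment _ _ ∅ (by simp) ?_).homotopic
    rintro ⟨p, hp⟩ t h0 h1
    obtain ⟨i, hi⟩ := hcover ⟨p, hp⟩
    change (1 - t) • R₀ p + t • p ∈ _
    rw [hR₀ p hp i hi]
    obtain ⟨hp, σ, hσ, hs⟩ := hp
    exact segment_mem_geometricRealization hσ (radialExpand_mem _ hp) hp (fun u hu => hs u fun h =>
        hu (radialExpand_apply_eq_zero _ hp h)) hs h0 h1
  choose e he using fun i =>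
    exists_homeomorph_simplexBoundary_unitSphere x (hx i) (hcard i) (b i)
  obtain ⟨E⟩ := Wedge.homotopyEquiv_of_homeomorph e he
  exact ⟨ContinuousMap.HomotopyEquiv.trans ⟨f, g, hgf, hfg⟩ E⟩

end ConeWithSimplices

/-! ### Sequential element matchings -/

section SequentialMatching

variable {X : Type*} [DecidableEq X]

theorem mem_elementMatching_iff {S : Set (Finset X)} {x : X} {σ τ : Finset X} (hσ : x ∉ σ)
    (hστ : σ ⊆ τ) :
    s(σ, τ) ∈ elementMatching S x ↔ σ ∈ S ∧ τ ∈ S ∧ τ = insert x σ := by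
  constructor
  · rintro ⟨ρ, h1, h2, h3⟩
    rcases Sym2.eq_iff.1 h3 with ⟨rfl, rfl⟩ | ⟨rfl, rfl⟩
    · refine ⟨h1, h2, ?_⟩
      ext u; by_cases h : u = x <;> simp [h]
    · simp at hσ
  · rintro ⟨h1, h2, rfl⟩
    exact ⟨σ, by rwa [Finset.erase_eq_of_notMem hσ], h2, by rw [Finset.erase_eq_of_notMem hσ]⟩

theorem mem_elementMatching {S : Set (Finset X)} {x : X} {e : Sym2 (Finset X)}
    (he : e ∈ elementMatching S x) :
    ∃ σ, x ∉ σ ∧ σ ∈ S ∧ insert x σ ∈ S ∧ e = s(σ, insert x σ) := by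
  obtain ⟨ρ, h1, h2, rfl⟩ := he
  have h3 : insert x (ρ.erase x) = insert x ρ := by
    ext u; by_cases h : u = x <;> simp [h]
  exact ⟨ρ.erase x, by simp, h1, by rwa [h3], by rw [h3]⟩

theorem mem_criticalSets_elementMatching {S : Set (Finset X)} {x : X} {σ : Finset X} :
    σ ∈ criticalSets S (elementMatching S x) ↔
      σ ∈ S ∧ ¬ (σ.erase x ∈ S ∧ insert x σ ∈ S) := by
  refine and_congr_right fun hσ => ⟨fun h hS => ?_, fun h e he hσe => ?_⟩
  · refine h _ ⟨σ, hS.1, hS.2, rfl⟩ ?_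
    rw [Sym2.mem_iff]
    by_cases hx : x ∈ σ
    · right; rw [Finset.insert_eq_of_mem hx]
    · left; rw [Finset.erase_eq_of_notMem hx]
  · obtain ⟨ρ, h1, h2, rfl⟩ := he
    apply h
    rcases Sym2.mem_iff.1 hσe with rfl | rfl
    · refine ⟨by simpa using h1, ?_⟩
      convert h2 using 1
      ext u; by_cases h : u = x <;> simp [h]
    · refine ⟨?_, by simpa using h2⟩
      convert h1 using 1
      ext u; by_cases h : u = x <;> simp [h]

theorem criticalSets_sequentialMatching_cons (S : Set (Finset X)) (x : X) (l : List X) :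
    criticalSets S (sequentialMatching S (x :: l)) =
      criticalSets (criticalSets S (elementMatching S x))
        (sequentialMatching (criticalSets S (elementMatching S x)) l) := by
  ext σ
  simp only [criticalSets, sequentialMatching, Set.mem_union]
  constructor
  · rintro ⟨h1, h2⟩
    exact ⟨⟨h1, fun e he => h2 e (Or.inl he)⟩, fun e he => h2 e (Or.inr he)⟩
  · rintro ⟨⟨h1, h2⟩, h3⟩
    exact ⟨h1, fun e he => he.elim (h2 e) (h3 e)⟩

theorem sequentialMatching_mem (l : List X) : ∀ (S : Set (Finset X)),
    ∀ e ∈ sequentialMatching S l, ∀ σ ∈ e, σ ∈ S := by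
  induction l with
  | nil => rintro S e ⟨⟩
  | cons x l ih =>
    rintro S e (he | he) σ hσ
    · obtain ⟨ρ, h1, h2, rfl⟩ := he
      rcases Sym2.mem_iff.1 hσ with rfl | rfl <;> assumption
    · exact (ih _ e he σ hσ).1

theorem sequentialMatching_eq_of_mem (l : List X) : ∀ (S : Set (Finset X)),
    ∀ e ∈ sequentialMatching S l, ∀ e' ∈ sequentialMatching S l, ∀ σ, σ ∈ e → σ ∈ e' → e = e' := by
  induction l with
  | nil => rintro S e ⟨⟩
  | cons x l ih =>
    rintro S e (he | he) e' (he' | he') σ hσ hσ'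
    · obtain ⟨ρ, hρ, -, -, rfl⟩ := mem_elementMatching he
      obtain ⟨ρ', hρ', -, -, rfl⟩ := mem_elementMatching he'
      have h : ∀ ρ : Finset X, x ∉ ρ → σ ∈ s(ρ, insert x ρ) → ρ = σ.erase x := by
        intro ρ hρ h
        rcases Sym2.mem_iff.1 h with rfl | rfl
        · rw [Finset.erase_eq_of_notMem hρ]
        · rw [Finset.erase_insert hρ]
      rw [h ρ hρ hσ, h ρ' hρ' hσ']
    · exact absurd hσ ((sequentialMatching_mem l _ e' he' σ hσ').2 e he)
    · exact absurd hσ' ((sequentialMatching_mem l _ e he σ hσ).2 e' he')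
    · exact ih _ e he e' he' σ hσ hσ'

theorem sequentialMatching_eq_insert (l : List X) : ∀ (S : Set (Finset X)),
    ∀ e ∈ sequentialMatching S l, ∃ x σ, x ∉ σ ∧ e = s(σ, insert x σ) := by
  induction l with
  | nil => rintro S e ⟨⟩
  | cons x l ih =>
    rintro S e (he | he)
    · obtain ⟨ρ, hρ, -, -, rfl⟩ := mem_elementMatching he
      exact ⟨x, ρ, hρ, rfl⟩
    · exact ih _ e he

theorem coveredIn_insert (S : Set (Finset X)) {x : X} {σ : Finset X} (hx : x ∉ σ) :
    CoveredIn S σ (insert x σ) := by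
  refine ⟨Finset.ssubset_insert hx, fun ρ _ ⟨h1, h2⟩ => ?_⟩
  have h3 := Finset.card_lt_card h1
  have h4 := Finset.card_lt_card h2
  rw [Finset.card_insert_of_notMem hx] at h4
  omega

/-- In a lower set the intermediate set `insert x σ` is again a member, so nothing larger can cover
`σ`. -/
theorem CoveredIn.exists_eq_insert {S : Set (Finset X)} (hS : IsLowerSet S) {σ τ : Finset X}
    (hτ : τ ∈ S) (h : CoveredIn S σ τ) : ∃ x ∉ σ, τ = insert x σ := by
  obtain ⟨x, hxτ, hxσ⟩ := Finset.exists_of_ssubset h.1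
  have hsub : insert x σ ⊆ τ := Finset.insert_subset hxτ h.1.subset
  refine ⟨x, hxσ, ?_⟩
  by_contra hne
  exact h.2 _ (hS hsub hτ) ⟨Finset.ssubset_insert hxσ, hsub.ssubset_of_ne (Ne.symm hne)⟩

theorem finRotate_ne {t : ℕ} (ht : 2 ≤ t) (i : Fin t) : finRotate t i ≠ i := by
  obtain ⟨k, rfl⟩ : ∃ k, t = k + 2 := ⟨t - 2, by omega⟩
  rw [finRotate_apply]
  intro h
  simp at h

/-- A sequential element matching admits no cycle in which the sets increase and decrease by one
element at a time. -/
theorem sequentialMatching_no_cycle {t : ℕ} (ht : 2 ≤ t) {σ τ : Fin t → Finset X}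
    (hinj : Function.Injective σ) (hsub : ∀ i, σ i ⊆ τ i)
    (hup : ∀ i, ∃ y ∉ σ i, τ (finRotate t i) = insert y (σ i)) (l : List X) :
    ∀ S : Set (Finset X), ¬ ∀ i, s(σ i, τ i) ∈ sequentialMatching S l := by
  induction l with
  | nil => exact fun S h => h ⟨0, by omega⟩
  | cons x l ih =>
    intro S h
    -- If no pair of the cycle uses `x`, the cycle lives in the later matchings. Otherwise the
    -- presence of `x` is followed once around the cycle.
    by_cases hx : ∃ i, s(σ i, τ i) ∈ elementMatching S x
    · obtain ⟨i₀, hi₀⟩ := hx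
      have hS : ∀ i, σ i ∈ S ∧ τ i ∈ S := fun i =>
        ⟨sequentialMatching_mem _ S _ (h i) _ (Sym2.mem_mk_left _ _),
          sequentialMatching_mem _ S _ (h i) _ (Sym2.mem_mk_right _ _)⟩
      -- If the added element were `x`, then `σ i` and the next `τ` would form a pair of the element
      -- matching, which takes every available pair. Uniqueness of partners would make two
      -- consecutive `σ` equal.
      have hstep : ∀ i, x ∉ σ i → x ∉ τ (finRotate t i) := by
        intro i hi hxτ
        obtain ⟨y, hy, hτ⟩ := hup i
        have hyx : x = y := by
          rw [hτ, Finset.mem_insert] at hxτ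
          exact hxτ.resolve_right hi
        subst hyx
        have hmem : s(σ i, τ (finRotate t i)) ∈ sequentialMatching S (x :: l) :=
          Or.inl ((mem_elementMatching_iff hi (hτ ▸ Finset.subset_insert _ _)).2
            ⟨(hS i).1, (hS _).2, hτ⟩)
        have heq := sequentialMatching_eq_of_mem _ S _ hmem _ (h (finRotate t i)) _
          (Sym2.mem_mk_right _ _) (Sym2.mem_mk_right _ _)
        have : σ i = σ (finRotate t i) := Sym2.congr_left.1 heq
        exact finRotate_ne ht i (hinj this).symm
      have hx₀ : x ∈ τ i₀ ∧ x ∉ σ i₀ := by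
        obtain ⟨ρ, hρ, -, -, he⟩ := mem_elementMatching hi₀
        rcases Sym2.eq_iff.1 he with ⟨h1, h2⟩ | ⟨h1, h2⟩
        · rw [h1, h2]
          exact ⟨Finset.mem_insert_self _ _, hρ⟩
        · have := hsub i₀ (h1 ▸ Finset.mem_insert_self x ρ)
          exact absurd (h2 ▸ this) hρ
      have hiter : ∀ k : ℕ, x ∉ σ ((finRotate t ^ k) i₀) := by
        intro k
        induction k with
        | zero => exact hx₀.2
        | succ k ihk =>
          rw [pow_succ', Equiv.Perm.mul_apply]
          exact fun hh => hstep _ ihk (hsub _ hh)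
      -- One step after `orderOf (finRotate t) - 1` rotations the index is `i₀` again, where `x ∈ τ
      -- i₀`.
      have hlast := hstep _ (hiter (orderOf (finRotate t) - 1))
      rw [← Equiv.Perm.mul_apply, ← pow_succ', Nat.sub_add_cancel (orderOf_pos _),
        pow_orderOf_eq_one] at hlast
      exact hlast hx₀.1
    · push Not at hx
      exact ih _ fun i => (h i).resolve_left (hx i)

/-- Sequential element matchings on a simplicial complex are acyclic. -/
theorem isAcyclicMatching_sequentialMatching {S : Set (Finset X)} (hS : IsLowerSet S)
    (l : List X) : IsAcyclicMatching S (sequentialMatching S l) where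
  mem_of_mem := sequentialMatching_mem l S
  eq_of_mem := sequentialMatching_eq_of_mem l S
  covered := by
    intro σ τ h
    obtain ⟨x, ρ, hx, he⟩ := sequentialMatching_eq_insert l S _ h
    rcases Sym2.eq_iff.1 he with ⟨rfl, rfl⟩ | ⟨rfl, rfl⟩
    · exact Or.inl (coveredIn_insert S hx)
    · exact Or.inr (coveredIn_insert S hx)
  acyclic := by
    rintro t ht ⟨σ, τ, hinj, h⟩
    refine sequentialMatching_no_cycle ht hinj (fun i => (h i).2.1.1.subset) (fun i => ?_) l S
      fun i => (h i).1
    exact (h i).2.2.exists_eq_insert hS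
      (sequentialMatching_mem l S _ (h _).1 _ (Sym2.mem_mk_right _ _))

end SequentialMatching

/-! ### Faces of total cut complexes -/

/-- A facet omits exactly one nonadjacent pair, so being a face means that the complement is not a
clique; this is the form used from here on. -/
theorem mem_totalCutComplex_two {V : Type*} [Fintype V] [DecidableEq V] {G : SimpleGraph V}
    {σ : Finset V} :
    σ ∈ totalCutComplex 2 G ↔ ∃ a b, a ∉ σ ∧ b ∉ σ ∧ a ≠ b ∧ ¬ G.Adj a b := by
  constructor
  · rintro ⟨F, hF, h2, hind⟩
    obtain ⟨a, b, hab, he⟩ := Finset.card_eq_two.1 h2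
    have ha : a ∈ Fᶜ := by simp [he]
    have hb : b ∈ Fᶜ := by simp [he]
    exact ⟨a, b, fun h => Finset.mem_compl.1 ha (hF h), fun h => Finset.mem_compl.1 hb (hF h), hab,
      hind (by exact_mod_cast ha) (by exact_mod_cast hb) hab⟩
  · rintro ⟨a, b, ha, hb, hab, hadj⟩
    refine ⟨{a, b}ᶜ, ?_, ?_, ?_⟩
    · intro u hu
      simp only [Finset.mem_compl, Finset.mem_insert, Finset.mem_singleton, not_or]
      exact ⟨fun h => ha (h ▸ hu), fun h => hb (h ▸ hu)⟩
    · rw [compl_compl, Finset.card_pair hab]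
    · rw [compl_compl]
      intro u hu v hv huv
      simp only [Finset.coe_insert, Finset.coe_singleton, Set.mem_insert_iff,
        Set.mem_singleton_iff] at hu hv
      rcases hu with rfl | rfl <;> rcases hv with rfl | rfl
      · exact absurd rfl huv
      · exact hadj
      · exact fun h => hadj h.symm
      · exact absurd rfl huv

/-! ### The stages of the matching on the product of a complete graph and a cycle -/

section ProductCells

variable {m n : ℕ}

theorem completeBoxCycle_adj (hn : 2 ≤ n) {p q : Fin m × Fin n} :
    (completeBoxCycle m n).Adj p q ↔ (p.1 ≠ q.1 ∧ p.2 = q.2) ∨ (p.1 = q.1 ∧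
      (p.2.val + 1 = q.2.val ∨ q.2.val + 1 = p.2.val ∨ (p.2.val = 0 ∧ q.2.val + 1 = n) ∨
        (q.2.val = 0 ∧ p.2.val + 1 = n))) := by
  have h : (SimpleGraph.cycleGraph n).Adj p.2 q.2 ↔
      (p.2.val + 1 = q.2.val ∨ q.2.val + 1 = p.2.val ∨ (p.2.val = 0 ∧ q.2.val + 1 = n) ∨
        (q.2.val = 0 ∧ p.2.val + 1 = n)) := by
    have h1 := p.2.isLt
    have h2 := q.2.isLt
    rw [SimpleGraph.cycleGraph_adj']
    rcases le_or_gt q.2 p.2 with h | h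
    · rw [Fin.sub_val_of_le h]
      rw [Fin.le_def] at h
      rcases h.eq_or_lt with h' | h'
      · rw [Fin.ext h', Fin.sub_val_of_le le_rfl]
        omega
      · rw [Fin.coe_sub_iff_lt.2 (Fin.lt_def.2 h')]
        omega
    · rw [Fin.sub_val_of_le h.le, Fin.coe_sub_iff_lt.2 h]
      rw [Fin.lt_def] at h
      omega
  rw [SimpleGraph.boxProd_adj, SimpleGraph.top_adj, h]
  tauto

/-- A clique with vertices in two different columns is an edge of a row. -/
theorem eq_pair_of_isClique (hn : 4 ≤ n) {B : Finset (Fin m × Fin n)}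
    (hB : (completeBoxCycle m n).IsClique B) {b c : Fin m × Fin n} (hb : b ∈ B) (hc : c ∈ B)
    (hbc : b.2 ≠ c.2) : b.1 = c.1 ∧ B = {b, c} := by
  have hadj : ∀ {p q : Fin m × Fin n}, p ∈ B → q ∈ B → p ≠ q →
      (completeBoxCycle m n).Adj p q := fun hp hq h => hB hp hq h
  have h1 := (completeBoxCycle_adj (by omega)).1 (hadj hb hc fun h => hbc (h ▸ rfl))
  have h2 : b.1 = c.1 := by tauto
  refine ⟨h2, ?_⟩
  ext a
  rw [Finset.mem_insert, Finset.mem_singleton]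
  refine ⟨fun ha => ?_, fun h => h.elim (fun h => h ▸ hb) (fun h => h ▸ hc)⟩
  by_contra hne
  rw [not_or] at hne
  -- A third vertex `a` in the same row would close a triangle in the cycle, impossible for `n ≥ 4`;
  -- in another row it would share its column with both `b` and `c`.
  have h3 := (completeBoxCycle_adj (by omega)).1 (hadj ha hb hne.1)
  have h4 := (completeBoxCycle_adj (by omega)).1 (hadj ha hc hne.2)
  simp only [Ne, Fin.ext_iff] at h1 h2 h3 h4 hbc
  omega

variable [NeZero m]

/-- The sets `{(0, k + 1)}` and `{(0, k), (0, k + 1)}` with `1 ≤ k ≤ n - 3`. -/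
def IsRowPair (k : Fin n) (B : Finset (Fin m × Fin n)) : Prop :=
  1 ≤ k.val ∧ k.val + 3 ≤ n ∧ ∃ l : Fin n, l.val = k.val + 1 ∧ B.erase (0, k) = {(0, l)}

/-- The subsets of the `k`-th column, `1 ≤ k`, with a vertex different from `(0, k)`. -/
def IsColumnPair (k : Fin n) (B : Finset (Fin m × Fin n)) : Prop :=
  1 ≤ k.val ∧ (B.erase (0, k)).Nonempty ∧ ∀ b ∈ B.erase (0, k), b.2 = k

theorem erase_erase_self {X : Type*} [DecidableEq X] (B : Finset X) (v : X) :
    (B.erase v).erase v = B.erase v := by simp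

theorem erase_insert_self {X : Type*} [DecidableEq X] (B : Finset X) (v : X) :
    (insert v B).erase v = B.erase v := by
  ext u; by_cases h : u = v <;> simp [h]

/-- Both pair predicates see `B` only through `B.erase (0, k)` and are therefore invariant under
toggling `(0, k)`. -/
theorem IsRowPair.erase {k : Fin n} {B : Finset (Fin m × Fin n)} (h : IsRowPair k B) :
    IsRowPair k (B.erase (0, k)) := by
  rwa [IsRowPair, erase_erase_self]

theorem IsRowPair.insert {k : Fin n} {B : Finset (Fin m × Fin n)} (h : IsRowPair k B) :
    IsRowPair k (insert (0, k) B) := by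
  rwa [IsRowPair, erase_insert_self]

theorem IsColumnPair.erase {k : Fin n} {B : Finset (Fin m × Fin n)} (h : IsColumnPair k B) :
    IsColumnPair k (B.erase (0, k)) := by
  rwa [IsColumnPair, erase_erase_self]

theorem IsColumnPair.insert {k : Fin n} {B : Finset (Fin m × Fin n)} (h : IsColumnPair k B) :
    IsColumnPair k (insert (0, k) B) := by
  rwa [IsColumnPair, erase_insert_self]

theorem IsRowPair.mem {k : Fin n} {B : Finset (Fin m × Fin n)} (h : IsRowPair k B) :
    ∃ l : Fin n, l.val = k.val + 1 ∧ ((0, l) : Fin m × Fin n) ∈ B ∧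
      ∀ b ∈ B, b = (0, k) ∨ b = (0, l) := by
  obtain ⟨-, -, l, hl, he⟩ := h
  refine ⟨l, hl, Finset.mem_of_mem_erase (a := ((0, k) : Fin m × Fin n)) (by simp [he]),
    fun b hb => ?_⟩
  by_cases hbk : b = (0, k)
  · exact Or.inl hbk
  · right
    have : b ∈ B.erase (0, k) := Finset.mem_erase.2 ⟨hbk, hb⟩
    simpa [he] using this

theorem IsColumnPair.mem {k : Fin n} {B : Finset (Fin m × Fin n)} (h : IsColumnPair k B) :
    (∃ b ∈ B, b.1 ≠ 0 ∧ b.2 = k) ∧ ∀ b ∈ B, b.2 = k := by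
  obtain ⟨-, ⟨b, hb⟩, hall⟩ := h
  have hbk := hall b hb
  rw [Finset.mem_erase] at hb
  refine ⟨⟨b, hb.2, fun h0 => hb.1 (Prod.ext h0 hbk), hbk⟩, fun c hc => ?_⟩
  by_cases hck : c = (0, k)
  · rw [hck]
  · exact hall c (Finset.mem_erase.2 ⟨hck, hc⟩)

theorem IsRowPair.unique {k k' : Fin n} {B : Finset (Fin m × Fin n)} (h : IsRowPair k B)
    (h' : IsRowPair k' B) : k = k' := by
  obtain ⟨l, hl, hlB, hall⟩ := h.mem
  obtain ⟨l', hl', hlB', hall'⟩ := h'.mem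
  have h1 := hall' _ hlB
  have h2 := hall _ hlB'
  simp only [Prod.mk.injEq, true_and, Fin.ext_iff] at h1 h2 ⊢
  omega

theorem IsColumnPair.unique {k k' : Fin n} {B : Finset (Fin m × Fin n)} (h : IsColumnPair k B)
    (h' : IsColumnPair k' B) : k = k' := by
  obtain ⟨b, hb, -, hbk⟩ := h.mem.1
  exact hbk.symm.trans (h'.mem.2 b hb)

theorem IsColumnPair.not_isRowPair {k k' : Fin n} {B : Finset (Fin m × Fin n)}
    (h : IsColumnPair k B) : ¬ IsRowPair k' B := by
  intro h'
  obtain ⟨b, hb, hb0, -⟩ := h.mem.1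
  obtain ⟨l, -, -, hall⟩ := h'.mem
  rcases hall b hb with rfl | rfl <;> exact hb0 rfl

variable [NeZero n]

/-- The set whose complement consists of the vertex `(0, 0)` and of `B`. -/
def cutFace (B : Finset (Fin m × Fin n)) : Finset (Fin m × Fin n) := (insert (0, 0) B)ᶜ

theorem mem_cutFace {B : Finset (Fin m × Fin n)} {v : Fin m × Fin n} :
    v ∈ cutFace B ↔ v ≠ (0, 0) ∧ v ∉ B := by
  simp [cutFace]

theorem cutFace_injOn {B B' : Finset (Fin m × Fin n)} (hB : (0, 0) ∉ B) (hB' : (0, 0) ∉ B')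
    (h : cutFace B = cutFace B') : B = B' := by
  rw [cutFace, cutFace, compl_inj_iff] at h
  rw [← Finset.erase_insert hB, h, Finset.erase_insert hB']

theorem erase_cutFace (B : Finset (Fin m × Fin n)) (v : Fin m × Fin n) :
    (cutFace B).erase v = cutFace (insert v B) := by
  ext u
  simp only [Finset.mem_erase, mem_cutFace, Finset.mem_insert, not_or]
  tauto

theorem insert_cutFace (B : Finset (Fin m × Fin n)) {v : Fin m × Fin n} (hv : v ≠ (0, 0)) :
    insert v (cutFace B) = cutFace (B.erase v) := by
  ext u
  simp only [Finset.mem_erase, mem_cutFace, Finset.mem_insert]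
  by_cases h : u = v
  · simp [h, hv]
  · simp [h]

/-- The sets `B` for which `cutFace B` is a face that does not lie in the star of `(0, 0)`. -/
structure IsRelativeCell (B : Finset (Fin m × Fin n)) : Prop where
  notMem : (0, 0) ∉ B
  isClique : (completeBoxCycle m n).IsClique B
  exists_not_adj : ∃ b ∈ B, ¬ (completeBoxCycle m n).Adj (0, 0) b

theorem IsRowPair.isRelativeCell (hn : 4 ≤ n) {k : Fin n} {B : Finset (Fin m × Fin n)}
    (h : IsRowPair k B) : IsRelativeCell B := by
  obtain ⟨l, hl, hlB, hall⟩ := h.mem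
  obtain ⟨h1, h3, -⟩ := h
  have h0 : ((0 : Fin n) : ℕ) = 0 := by simp
  refine ⟨fun hx => ?_, fun b hb c hc hbc => ?_, _, hlB, ?_⟩
  · have := hall _ hx
    simp only [Prod.mk.injEq, true_and, Fin.ext_iff] at this
    omega
  · rw [completeBoxCycle_adj (by omega)]
    rcases hall b hb with rfl | rfl <;> rcases hall c hc with rfl | rfl
    · exact absurd rfl hbc
    · right; exact ⟨rfl, Or.inl hl.symm⟩
    · right; exact ⟨rfl, Or.inr (Or.inl hl.symm)⟩
    · exact absurd rfl hbc
  · rw [completeBoxCycle_adj (by omega)]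
    simp only [ne_eq, not_true_eq_false, false_and, true_and, false_or]
    omega

theorem IsColumnPair.isRelativeCell (hn : 4 ≤ n) {k : Fin n} {B : Finset (Fin m × Fin n)}
    (h : IsColumnPair k B) : IsRelativeCell B := by
  obtain ⟨⟨b, hb, hb0, hbk⟩, hall⟩ := h.mem
  have h1 := h.1
  have h0 : ((0 : Fin n) : ℕ) = 0 := by simp
  refine ⟨fun hx => ?_, fun b hb c hc hbc => ?_, b, hb, ?_⟩
  · have := hall _ hx
    simp only [Fin.ext_iff] at this
    omega
  · rw [completeBoxCycle_adj (by omega)]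
    left
    have h2 : b.2 = c.2 := (hall b hb).trans (hall c hc).symm
    exact ⟨fun h => hbc (Prod.ext h h2), h2⟩
  · rw [completeBoxCycle_adj (by omega)]
    rintro (⟨-, h⟩ | ⟨h, -⟩)
    · simp only [hbk, Fin.ext_iff] at h
      omega
    · exact hb0 h.symm

/-- The non-neighbours of `(0, 0)` in its row are in columns `2` to `n - 2`, which are the columns
`k + 1` for the indices `k` allowed in `IsRowPair`. -/
theorem le_of_not_adj (hn : 4 ≤ n) {l : Fin n}
    (h : ¬ (completeBoxCycle m n).Adj (0, 0) (0, l)) (h0 : l ≠ 0) : 2 ≤ l.val ∧ l.val + 2 ≤ n := by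
  have hz : ((0 : Fin n) : ℕ) = 0 := by simp
  rw [completeBoxCycle_adj (by omega)] at h
  simp only [ne_eq, not_true_eq_false, false_and, true_and, false_or, Fin.ext_iff] at h h0
  omega

/-- A relative cell contained in the first row and in a single column is a member of a row pair. -/
theorem IsRelativeCell.isRowPair_of_subset (hn : 4 ≤ n) {k : Fin n} {B : Finset (Fin m × Fin n)}
    (hB : IsRelativeCell B) (h : ∀ b ∈ B, b = (0, k)) : ∃ l, l < k ∧ IsRowPair l B := by
  obtain ⟨hx, -, b, hb, hadj⟩ := hB
  have hk := h b hb
  subst hk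
  obtain ⟨h2, h3⟩ := le_of_not_adj hn hadj (fun h => hx (h ▸ hb))
  -- The singleton `{(0, k)}` is the smaller member of the row pair of index `k - 1`.
  refine ⟨⟨k.val - 1, by omega⟩, by rw [Fin.lt_def]; simp only; omega, by simp only; omega,
    by simp only; omega, k, by simp only; omega, ?_⟩
  rw [Finset.erase_eq_of_notMem]
  · exact Finset.eq_singleton_iff_unique_mem.2 ⟨hb, h⟩
  · intro hc
    have := h _ hc
    simp only [Prod.mk.injEq, true_and, Fin.ext_iff] at this
    omega

/-- The sets `B` that correspond to the critical faces. -/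
def IsCriticalCell (B : Finset (Fin m × Fin n)) : Prop :=
  (∃ i : Fin m, i ≠ 0 ∧ ∃ j' j : Fin n, j'.val + 1 = j.val ∧ B = {(i, j'), (i, j)}) ∨
  (∃ i : Fin m, i ≠ 0 ∧ ∃ l : Fin n, l.val + 1 = n ∧ B = {(i, 0), (i, l)}) ∨
  ∃ l' l : Fin n, l'.val + 2 = n ∧ l.val + 1 = n ∧ B = {(0, l'), (0, l)}

theorem IsCriticalCell.card_eq (hn : 4 ≤ n) {B : Finset (Fin m × Fin n)} (h : IsCriticalCell B) :
    B.card = 2 := by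
  have hz : ((0 : Fin n) : ℕ) = 0 := by simp
  rcases h with ⟨i, -, j', j, hj, rfl⟩ | ⟨i, -, l, hl, rfl⟩ | ⟨l', l, hl', hl, rfl⟩ <;>
  · apply Finset.card_pair
    simp only [ne_eq, Prod.mk.injEq, true_and, Fin.ext_iff]
    omega

/-- A cell within one column is in a column pair, unless it is `{(0, k)}`, which is in a row pair.
So a surviving cell is a row edge; in row `0` the edge from `a` to `a + 1` survives only for `a = n
- 2`. -/
theorem IsRelativeCell.isCriticalCell (hn : 4 ≤ n) {B : Finset (Fin m × Fin n)}
    (hB : IsRelativeCell B) (hrow : ∀ k, ¬ IsRowPair k B) (hcol : ∀ k, ¬ IsColumnPair k B) :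
    IsCriticalCell B := by
  have hz : ((0 : Fin n) : ℕ) = 0 := by simp
  obtain ⟨hx, hcl, b, hb, hadj⟩ := id hB
  have hbx : b ≠ (0, 0) := fun h => hx (h ▸ hb)
  have hb1 : 1 ≤ b.2.val := by
    by_contra h
    apply hadj
    rw [completeBoxCycle_adj (by omega)]
    have h2 : (0 : Fin n) = b.2 := by rw [Fin.ext_iff]; omega
    exact Or.inl ⟨fun h1 => hbx (Prod.ext h1.symm h2.symm), h2⟩
  have hex : ∃ c ∈ B, b.2 ≠ c.2 := by
    by_contra! hall
    have hempty : B.erase (0, b.2) = ∅ := by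
      by_contra hne
      exact hcol b.2 ⟨hb1, Finset.nonempty_iff_ne_empty.2 hne,
        fun c hc => (hall c (Finset.mem_of_mem_erase hc)).symm⟩
    obtain ⟨l, -, hl⟩ := hB.isRowPair_of_subset hn (k := b.2) fun c hc => by
      by_contra hne
      exact Finset.notMem_empty c (hempty ▸ Finset.mem_erase.2 ⟨hne, hc⟩)
    exact hrow l hl
  obtain ⟨c, hc, hbc⟩ := hex
  obtain ⟨h1, rfl⟩ := eq_pair_of_isClique hn hcl hb hc hbc
  have hadj' := (completeBoxCycle_adj (by omega)).1 (hcl hb hc fun h => hbc (h ▸ rfl))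
  have h2 := (hadj'.resolve_left fun h => hbc h.2).2
  obtain ⟨i, j⟩ := b
  obtain ⟨i', j'⟩ := c
  obtain rfl : i = i' := h1
  simp only at h2 hb1 hbc
  by_cases hi : i = 0
  · subst hi
    have hj0 : j'.val ≠ 0 := by
      intro h
      apply hx
      have : j' = 0 := by rw [Fin.ext_iff]; omega
      simp [this]
    right; right
    have key : ∀ a c : Fin n, a.val + 1 = c.val → 1 ≤ a.val →
        ({(0, j), (0, j')} : Finset (Fin m × Fin n)) = {(0, a), (0, c)} → a.val + 2 = n := by
      intro a c hac ha he
      by_contra hne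
      refine hrow a ⟨ha, by omega, c, hac.symm, ?_⟩
      rw [he, Finset.erase_insert]
      simp only [Finset.mem_singleton, Prod.mk.injEq, true_and, Fin.ext_iff]
      omega
    rcases h2 with h | h | h | h
    · have := key j j' h hb1 rfl
      exact ⟨j, j', this, by omega, rfl⟩
    · have := key j' j h (by omega) (Finset.pair_comm _ _)
      exact ⟨j', j, this, by omega, Finset.pair_comm _ _⟩
    · omega
    · omega
  · rcases h2 with h | h | h | h
    · exact Or.inl ⟨i, hi, j, j', h, rfl⟩
    · exact Or.inl ⟨i, hi, j', j, h, Finset.pair_comm _ _⟩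
    · omega
    · have : j' = 0 := by rw [Fin.ext_iff]; omega
      exact Or.inr (Or.inl ⟨i, hi, j, h.2, by rw [this, Finset.pair_comm]⟩)

theorem IsCriticalCell.isRelativeCell (hn : 4 ≤ n) {B : Finset (Fin m × Fin n)}
    (h : IsCriticalCell B) :
    IsRelativeCell B ∧ (∀ k, ¬ IsRowPair k B) ∧ ∀ k, ¬ IsColumnPair k B := by
  have hz : ((0 : Fin n) : ℕ) = 0 := by simp
  have hcol : ∀ b c : Fin m × Fin n, b ∈ B → c ∈ B → b.2 ≠ c.2 → ∀ k, ¬ IsColumnPair k B :=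
    fun b c hb hc hbc k hk => hbc ((hk.mem.2 b hb).trans (hk.mem.2 c hc).symm)
  have hclique : ∀ b c : Fin m × Fin n, (completeBoxCycle m n).Adj b c →
      (completeBoxCycle m n).IsClique (({b, c} : Finset _) : Set (Fin m × Fin n)) := by
    intro b c hbc
    rw [Finset.coe_pair]
    exact SimpleGraph.isClique_pair.2 fun _ => hbc
  have hrow : ∀ b ∈ B, b.1 ≠ 0 → ∀ k, ¬ IsRowPair k B := by
    intro b hb hb0 k hk
    obtain ⟨l, -, -, hall⟩ := hk.mem
    rcases hall b hb with rfl | rfl <;> exact hb0 rfl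
  rcases h with ⟨i, hi, j', j, hj, rfl⟩ | ⟨i, hi, l, hl, rfl⟩ | ⟨l', l, hl', hl, rfl⟩
  · refine ⟨⟨?_, hclique _ _ ?_, (i, j), by simp, ?_⟩, hrow (i, j) (by simp) hi,
      hcol (i, j) (i, j') (by simp) (by simp) ?_⟩
    · simp [Ne.symm hi]
    · rw [completeBoxCycle_adj (by omega)]
      refine Or.inr ⟨rfl, ?_⟩
      simp only
      omega
    · rw [completeBoxCycle_adj (by omega)]
      rintro (⟨-, h⟩ | ⟨h, -⟩)
      · simp only [Fin.ext_iff] at h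
        omega
      · exact hi h.symm
    · simp only [ne_eq, Fin.ext_iff]
      omega
  · refine ⟨⟨?_, hclique _ _ ?_, (i, l), by simp, ?_⟩, hrow (i, l) (by simp) hi,
      hcol (i, l) (i, 0) (by simp) (by simp) ?_⟩
    · simp [Ne.symm hi]
    · rw [completeBoxCycle_adj (by omega)]
      refine Or.inr ⟨rfl, ?_⟩
      simp only
      omega
    · rw [completeBoxCycle_adj (by omega)]
      rintro (⟨-, h⟩ | ⟨h, -⟩)
      · simp only [Fin.ext_iff] at h
        omega
      · exact hi h.symm
    · simp only [ne_eq, Fin.ext_iff]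
      omega
  · refine ⟨⟨?_, hclique _ _ ?_, (0, l'), by simp, ?_⟩, ?_,
      hcol (0, l) (0, l') (by simp) (by simp) ?_⟩
    · simp only [Finset.mem_insert, Finset.mem_singleton, Prod.mk.injEq, true_and, Fin.ext_iff]
      omega
    · rw [completeBoxCycle_adj (by omega)]
      refine Or.inr ⟨rfl, ?_⟩
      simp only
      omega
    · rw [completeBoxCycle_adj (by omega)]
      simp only [ne_eq, not_true_eq_false, false_and, true_and, false_or]
      omega
    · intro k hk
      obtain ⟨a, ha, -, hall⟩ := hk.mem
      have h3 := hk.2.1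
      have := hall (0, l) (by simp)
      simp only [Prod.mk.injEq, true_and, Fin.ext_iff] at this
      omega
    · simp only [ne_eq, Fin.ext_iff]
      omega

end ProductCells

/-! ### Faces described by relative cells, the matching stages, and the collapse. -/

section ProductMatching

variable {m n : ℕ}

theorem pair_eq_pair_of_succ {i a : Fin m} {j' j b' b : Fin n} (hj : j'.val + 1 = j.val)
    (hb : b'.val + 1 = b.val)
    (h : ({(i, j'), (i, j)} : Finset (Fin m × Fin n)) = {(a, b'), (a, b)}) :
    i = a ∧ j' = b' := by
  have h1 : (i, j') ∈ ({(a, b'), (a, b)} : Finset (Fin m × Fin n)) := by simp [← h]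
  have h2 : (i, j) ∈ ({(a, b'), (a, b)} : Finset (Fin m × Fin n)) := by simp [← h]
  simp only [Finset.mem_insert, Finset.mem_singleton, Prod.mk.injEq, Fin.ext_iff] at h1 h2 ⊢
  omega

variable [NeZero m] [NeZero n]

theorem cutFace_mem_totalCutComplex {B : Finset (Fin m × Fin n)} (hB : IsRelativeCell B) :
    cutFace B ∈ totalCutComplex 2 (completeBoxCycle m n) := by
  obtain ⟨b, hb, hadj⟩ := hB.exists_not_adj
  refine mem_totalCutComplex_two.2 ⟨(0, 0), b, ?_, ?_, fun h => hB.notMem (h ▸ hb), hadj⟩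
  · simp [mem_cutFace]
  · simp [mem_cutFace, hb]

/-- If adding `(0, 0)` destroys the face, the complement becomes a clique, so the nonadjacent pair
outside `σ` must have involved `(0, 0)`. -/
theorem insert_mem_totalCutComplex_or {σ : Finset (Fin m × Fin n)}
    (hσ : σ ∈ totalCutComplex 2 (completeBoxCycle m n)) :
    insert (0, 0) σ ∈ totalCutComplex 2 (completeBoxCycle m n) ∨
      IsRelativeCell (insert (0, 0) σ)ᶜ ∧ σ = cutFace (insert (0, 0) σ)ᶜ := by
  rw [or_iff_not_imp_left]
  intro hn
  have hcl : ∀ a b, a ∉ insert (0, 0) σ → b ∉ insert (0, 0) σ → a ≠ b →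
      (completeBoxCycle m n).Adj a b := by
    intro a b ha hb hab
    by_contra h
    exact hn (mem_totalCutComplex_two.2 ⟨a, b, ha, hb, hab, h⟩)
  have hxσ : (0, 0) ∉ σ := fun h => hn (by rwa [Finset.insert_eq_of_mem h])
  refine ⟨⟨by simp, fun a ha b hb hab =>
    hcl a b (Finset.mem_compl.1 ha) (Finset.mem_compl.1 hb) hab, ?_⟩, ?_⟩
  · obtain ⟨a, b, ha, hb, hab, hadj⟩ := mem_totalCutComplex_two.1 hσ
    by_cases hax : a = (0, 0)
    · subst hax
      exact ⟨b, by simp [hb, Ne.symm hab], hadj⟩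
    · by_cases hbx : b = (0, 0)
      · subst hbx
        exact ⟨a, by simp [ha, hab], fun h => hadj h.symm⟩
      · exact absurd (hcl a b (by simp [ha, hax]) (by simp [hb, hbx]) hab) hadj
  · ext u
    by_cases h : u = (0, 0)
    · simp [h, mem_cutFace, hxσ]
    · simp [h, mem_cutFace]

theorem insert_cutFace_notMem {B : Finset (Fin m × Fin n)} (hB : IsRelativeCell B) :
    insert (0, 0) (cutFace B) ∉ totalCutComplex 2 (completeBoxCycle m n) := by
  intro h
  obtain ⟨a, b, ha, hb, hab, hadj⟩ := mem_totalCutComplex_two.1 h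
  simp only [Finset.mem_insert, mem_cutFace, not_or, not_and, not_not] at ha hb
  exact hadj (hB.isClique (ha.2 ha.1) (hb.2 hb.1) hab)

/-- The sets `B` such that `cutFace B` is still unmatched when the vertex `(0, j)` is used. -/
def IsStageCell (j : ℕ) (B : Finset (Fin m × Fin n)) : Prop :=
  IsRelativeCell B ∧ ∀ k : Fin n, k.val < j → ¬ IsRowPair k B ∧ ¬ IsColumnPair k B

theorem IsRowPair.isStageCell (hn : 4 ≤ n) {j : Fin n} {B : Finset (Fin m × Fin n)}
    (h : IsRowPair j B) : IsStageCell j.val B :=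
  ⟨h.isRelativeCell hn, fun _ hk => ⟨fun hr => hk.ne (congrArg _ (hr.unique h)),
    fun hc => hc.not_isRowPair h⟩⟩

theorem IsColumnPair.isStageCell (hn : 4 ≤ n) {j : Fin n} {B : Finset (Fin m × Fin n)}
    (h : IsColumnPair j B) : IsStageCell j.val B :=
  ⟨h.isRelativeCell hn, fun _ hk => ⟨h.not_isRowPair,
    fun hc => hk.ne (congrArg _ (hc.unique h))⟩⟩

theorem isStageCell_toggle_iff (hn : 4 ≤ n) {j : Fin n} (hj : 1 ≤ j.val)
    {B : Finset (Fin m × Fin n)} (hx : (0, 0) ∉ B) :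
    (IsStageCell j.val (insert (0, j) B) ∧ IsStageCell j.val (B.erase (0, j))) ↔
      (IsRowPair j B ∨ IsColumnPair j B) := by
  have hz : ((0 : Fin n) : ℕ) = 0 := by simp
  constructor
  · rintro ⟨⟨hins, -⟩, ⟨hera, hlast⟩⟩
    obtain ⟨b₀, hb₀, hadj₀⟩ := hera.exists_not_adj
    by_cases hall : ∀ b ∈ B.erase (0, j), b.2 = j
    · exact Or.inr ⟨hj, ⟨b₀, hb₀⟩, hall⟩
    left
    push Not at hall
    obtain ⟨b, hb, hbj⟩ := hall
    have hbv := Finset.ne_of_mem_erase hb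
    have hbB := Finset.mem_of_mem_erase hb
    obtain ⟨h1, h2⟩ := eq_pair_of_isClique hn hins.isClique (Finset.mem_insert_self (0, j) B)
      (Finset.mem_insert_of_mem hbB) (Ne.symm hbj)
    have hsing : B.erase (0, j) = {b} := by
      rw [← erase_insert_self, h2, Finset.erase_insert (by simpa using Ne.symm hbv)]
    rw [hsing, Finset.mem_singleton] at hb₀
    subst hb₀
    have hadj := (completeBoxCycle_adj (by omega)).1 (hins.isClique
      (Finset.mem_coe.2 (Finset.mem_insert_self (0, j) B))
      (Finset.mem_coe.2 (Finset.mem_insert_of_mem hbB)) (Ne.symm hbv))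
    obtain ⟨i, l⟩ := b₀
    obtain rfl : 0 = i := h1
    have hl0 : l ≠ 0 := fun h => hx (h ▸ hbB)
    obtain ⟨hl2, hln⟩ := le_of_not_adj hn hadj₀ hl0
    simp only [ne_eq, not_true_eq_false, false_and, true_and, false_or] at hadj
    rcases hadj with h | h | h | h
    · exact ⟨hj, by omega, l, h.symm, hsing⟩
    -- Here `l = j - 1`, and the singleton `{(0, l)}` was already matched at an earlier index.
    · obtain ⟨k, hk, hkr⟩ := hera.isRowPair_of_subset hn (k := l) fun c hc => by
        simpa [hsing] using hc
      rw [Fin.lt_def] at hk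
      exact absurd hkr (hlast k (by omega)).1
    · omega
    · omega
  · rintro (h | h)
    · exact ⟨h.insert.isStageCell hn, h.erase.isStageCell hn⟩
    · exact ⟨h.insert.isStageCell hn, h.erase.isStageCell hn⟩

/-- The faces that are still unmatched when the vertex `(0, j)` is used. -/
def stageFaces (m n : ℕ) [NeZero m] [NeZero n] (j : ℕ) : Set (Finset (Fin m × Fin n)) :=
  {σ | ∃ B, IsStageCell j B ∧ σ = cutFace B}

theorem cutFace_mem_stageFaces {j : ℕ} {B : Finset (Fin m × Fin n)} (hx : (0, 0) ∉ B) :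
    cutFace B ∈ stageFaces m n j ↔ IsStageCell j B := by
  constructor
  · rintro ⟨B', hB', he⟩
    rwa [cutFace_injOn hx hB'.1.notMem he]
  · exact fun h => ⟨B, h, rfl⟩

theorem vertex_ne_zero {j : Fin n} (hj : 1 ≤ j.val) : ((0 : Fin m), j) ≠ (0, 0) := by
  intro h
  simp only [Prod.mk.injEq, true_and] at h
  simp [h] at hj

theorem criticalSets_stageFaces (hn : 4 ≤ n) {j : Fin n} (hj : 1 ≤ j.val) :
    criticalSets (stageFaces m n j.val) (elementMatching (stageFaces m n j.val) (0, j)) =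
      stageFaces m n (j.val + 1) := by
  have hv : ((0 : Fin m), j) ≠ (0, 0) := vertex_ne_zero hj
  ext σ
  rw [mem_criticalSets_elementMatching]
  have key : ∀ B, IsStageCell j.val B → (((cutFace B).erase (0, j) ∈ stageFaces m n j.val ∧
      insert (0, j) (cutFace B) ∈ stageFaces m n j.val) ↔ (IsRowPair j B ∨ IsColumnPair j B)) := by
    intro B hB
    have hx := hB.1.notMem
    rw [erase_cutFace, insert_cutFace _ hv, cutFace_mem_stageFaces,
      cutFace_mem_stageFaces, isStageCell_toggle_iff hn hj hx]
    · exact fun h => hx (Finset.mem_of_mem_erase h)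
    · simp only [Finset.mem_insert, not_or]
      exact ⟨Ne.symm hv, hx⟩
  constructor
  · rintro ⟨⟨B, hB, rfl⟩, h⟩
    rw [key B hB, not_or] at h
    refine ⟨B, ⟨hB.1, fun k hk => ?_⟩, rfl⟩
    rcases Nat.lt_succ_iff_lt_or_eq.1 hk with hk | hk
    · exact hB.2 k hk
    · rwa [Fin.ext hk]
  · rintro ⟨B, hB, rfl⟩
    have hB' : IsStageCell j.val B := ⟨hB.1, fun k hk => hB.2 k (by omega)⟩
    refine ⟨⟨B, hB', rfl⟩, ?_⟩
    rw [key B hB', not_or]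
    exact hB.2 j (by omega)

/-- Toggling `(0, 0)` matches precisely its star. The index `1` on the right imposes no further
condition, since row and column pairs have positive index. -/
theorem criticalSets_totalCutComplex :
    criticalSets (totalCutComplex 2 (completeBoxCycle m n) : Set (Finset (Fin m × Fin n)))
      (elementMatching (totalCutComplex 2 (completeBoxCycle m n) : Set (Finset (Fin m × Fin n)))
        (0, 0)) = stageFaces m n 1 := by
  ext σ
  rw [mem_criticalSets_elementMatching]
  constructor
  · rintro ⟨hσ, h⟩
    have h1 := (insert_mem_totalCutComplex_or hσ).resolve_left fun hins =>
      h ⟨(totalCutComplex 2 (completeBoxCycle m n)).lower (Finset.erase_subset _ _) hσ, hins⟩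
    refine ⟨_, ⟨h1.1, fun k hk => ⟨fun hr => ?_, fun hc => ?_⟩⟩, h1.2⟩
    · have := hr.1
      omega
    · have := hc.1
      omega
  · rintro ⟨B, hB, rfl⟩
    exact ⟨cutFace_mem_totalCutComplex hB.1, fun h => insert_cutFace_notMem hB.1 h.2⟩

/-- The critical sets of a sequential matching, computed stage by stage. -/
theorem criticalSets_sequentialMatching_finRange {X : Type*} [DecidableEq X] {n : ℕ}
    (S : ℕ → Set (Finset X)) (v : Fin n → X)
    (h : ∀ j : Fin n, criticalSets (S j.val) (elementMatching (S j.val) (v j)) = S (j.val + 1)) :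
    criticalSets (S 0) (sequentialMatching (S 0) ((List.finRange n).map v)) = S n := by
  induction n generalizing S with
  | zero =>
    ext σ
    simp [criticalSets, sequentialMatching]
  | succ n ih =>
    rw [List.finRange_succ, List.map_cons, List.map_map, criticalSets_sequentialMatching_cons]
    have h0 := h 0
    simp only [Fin.val_zero, zero_add] at h0
    rw [h0]
    exact ih (fun j => S (j + 1)) (v ∘ Fin.succ) fun j => h j.succ

theorem criticalFaces_eq :
    pathTypeFaces m n ∪ wrapFaces m n ∪ rowFaces m n =
      {σ | ∃ B, IsCriticalCell B ∧ σ = cutFace B} := by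
  ext σ
  have hc : ∀ B : Finset (Fin m × Fin n), σᶜ = insert (0, 0) B ↔ σ = cutFace B := fun B => by
    rw [cutFace, compl_eq_comm, eq_comm]
  simp only [Set.mem_union, pathTypeFaces, wrapFaces, rowFaces, Set.mem_ofPred_eq, IsCriticalCell]
  simp only [hc]
  constructor
  · rintro ((⟨i, hi, j', j, hj, h⟩ | ⟨i, hi, l, hl, h⟩) | ⟨l', l, hl', hl, h⟩)
    · exact ⟨_, Or.inl ⟨i, hi, j', j, hj, rfl⟩, h⟩
    · exact ⟨_, Or.inr (Or.inl ⟨i, hi, l, hl, rfl⟩), h⟩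
    · exact ⟨_, Or.inr (Or.inr ⟨l', l, hl', hl, rfl⟩), h⟩
  · rintro ⟨B, ⟨i, hi, j', j, hj, rfl⟩ | ⟨i, hi, l, hl, rfl⟩ | ⟨l', l, hl', hl, rfl⟩, h⟩
    · exact Or.inl (Or.inl ⟨i, hi, j', j, hj, h⟩)
    · exact Or.inl (Or.inr ⟨i, hi, l, hl, h⟩)
    · exact Or.inr ⟨l', l, hl', hl, h⟩

theorem stageFaces_last (hn : 4 ≤ n) :
    stageFaces m n n = pathTypeFaces m n ∪ wrapFaces m n ∪ rowFaces m n := by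
  rw [criticalFaces_eq]
  ext σ
  constructor
  · rintro ⟨B, hB, rfl⟩
    exact ⟨B, hB.1.isCriticalCell hn (fun k => (hB.2 k k.isLt).1) fun k => (hB.2 k k.isLt).2, rfl⟩
  · rintro ⟨B, hB, rfl⟩
    obtain ⟨h1, h2, h3⟩ := hB.isRelativeCell hn
    exact ⟨B, ⟨h1, fun k _ => ⟨h2 k, h3 k⟩⟩, rfl⟩

theorem criticalSets_productMatching (hn : 4 ≤ n) :
    criticalSets (totalCutComplex 2 (completeBoxCycle m n) : Set (Finset (Fin m × Fin n)))
      (productMatching m n) = pathTypeFaces m n ∪ wrapFaces m n ∪ rowFaces m n := by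
  rw [← stageFaces_last hn]
  -- Stage `0` is the whole complex and needs its own clause: `stageFaces m n 0` would already lack
  -- the star of `(0, 0)`.
  let S : ℕ → Set (Finset (Fin m × Fin n)) := fun j =>
    if j = 0 then totalCutComplex 2 (completeBoxCycle m n) else stageFaces m n j
  have h0 : S 0 = totalCutComplex 2 (completeBoxCycle m n) := if_pos rfl
  have hS : ∀ j, j ≠ 0 → S j = stageFaces m n j := fun j hj => if_neg hj
  have key := criticalSets_sequentialMatching_finRange S (fun j : Fin n => ((0 : Fin m), j)) (by
    intro j
    rw [hS _ (Nat.succ_ne_zero _)]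
    by_cases hj : j.val = 0
    · have hj' : j = 0 := by rw [Fin.ext_iff]; simpa using hj
      rw [hj, h0, hj']
      exact criticalSets_totalCutComplex
    · rw [hS _ hj]
      exact criticalSets_stageFaces hn (by omega))
  rwa [h0, hS n (by omega)] at key

/-! ### Counting the critical faces -/

theorem card_cutFace {B : Finset (Fin m × Fin n)} (hx : (0, 0) ∉ B) (hB : B.card = 2) :
    (cutFace B).card = m * n - 3 := by
  rw [cutFace, Finset.card_compl, Finset.card_insert_of_notMem hx, hB]
  simp

theorem ncard_pathTypeFaces : (pathTypeFaces m n).ncard = (m - 1) * (n - 1) := by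
  have hn := Nat.pos_of_ne_zero (NeZero.ne n)
  let f : {i : Fin m // i ≠ 0} × Fin (n - 1) → Finset (Fin m × Fin n) := fun p =>
    cutFace {(p.1.1, ⟨p.2.val, by omega⟩), (p.1.1, ⟨p.2.val + 1, by omega⟩)}
  have hf : Function.Injective f := by
    rintro ⟨⟨i, hi⟩, j⟩ ⟨⟨a, ha⟩, b⟩ h
    have h1 := cutFace_injOn (by simp [Ne.symm hi]) (by simp [Ne.symm ha]) h
    obtain ⟨h2, h3⟩ := pair_eq_pair_of_succ (j' := ⟨j.val, by omega⟩) (b' := ⟨b.val, by omega⟩)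
      rfl rfl h1
    simp only [Fin.mk.injEq] at h2 h3
    simp [h2, Fin.ext_iff, h3]
  have hr : pathTypeFaces m n = Set.range f := by
    ext σ
    constructor
    · rintro ⟨i, hi, j', j, hj, h⟩
      refine ⟨(⟨i, hi⟩, ⟨j'.val, by omega⟩), ?_⟩
      rw [← compl_compl σ, h]
      simp only [f, cutFace, hj]
    · rintro ⟨⟨⟨i, hi⟩, j⟩, rfl⟩
      exact ⟨i, hi, ⟨j.val, by omega⟩, ⟨j.val + 1, by omega⟩, rfl, by simp [f, cutFace]⟩
  rw [hr, Set.ncard_range_of_injective hf, Nat.card_eq_fintype_card]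
  simp

theorem ncard_wrapFaces (hn : 3 ≤ n) : (wrapFaces m n).ncard = m - 1 := by
  let f : {i : Fin m // i ≠ 0} → Finset (Fin m × Fin n) := fun p =>
    cutFace {(p.1, 0), (p.1, ⟨n - 1, by omega⟩)}
  have hf : Function.Injective f := by
    rintro ⟨i, hi⟩ ⟨a, ha⟩ h
    have h1 := cutFace_injOn (by simp [Ne.symm hi]) (by simp [Ne.symm ha]) h
    have h2 : (i, (0 : Fin n)) ∈ ({(a, 0), (a, ⟨n - 1, by omega⟩)} : Finset (Fin m × Fin n)) := by
      simp [← h1]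
    simp only [Finset.mem_insert, Finset.mem_singleton, Prod.mk.injEq] at h2
    rcases h2 with h2 | h2 <;> exact Subtype.ext h2.1
  have hr : wrapFaces m n = Set.range f := by
    ext σ
    constructor
    · rintro ⟨i, hi, l, hl, h⟩
      refine ⟨⟨i, hi⟩, ?_⟩
      have hl' : l = ⟨n - 1, by omega⟩ := by rw [Fin.ext_iff]; simp only; omega
      rw [← compl_compl σ, h, hl']
      simp only [f, cutFace]
    · rintro ⟨⟨i, hi⟩, rfl⟩
      exact ⟨i, hi, ⟨n - 1, by omega⟩, by simp only; omega, by simp [f, cutFace]⟩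
  rw [hr, Set.ncard_range_of_injective hf, Nat.card_eq_fintype_card]
  simp

theorem ncard_rowFaces (hn : 2 ≤ n) : (rowFaces m n).ncard = 1 := by
  rw [Set.ncard_eq_one]
  refine ⟨cutFace {(0, ⟨n - 2, by omega⟩), (0, ⟨n - 1, by omega⟩)}, ?_⟩
  ext σ
  rw [Set.mem_singleton_iff]
  constructor
  · rintro ⟨l', l, hl', hl, h⟩
    have e : l = ⟨n - 1, by omega⟩ := by rw [Fin.ext_iff]; simp only; omega
    have e' : l' = ⟨n - 2, by omega⟩ := by rw [Fin.ext_iff]; simp only; omega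
    simp only [e, e'] at h
    rw [← compl_compl σ, h]
    rfl
  · rintro rfl
    exact ⟨⟨n - 2, by omega⟩, ⟨n - 1, by omega⟩, by simp only; omega, by simp only; omega,
      by simp [cutFace]⟩

theorem ncard_criticalFaces (hm : 1 ≤ m) (hn : 4 ≤ n) :
    (pathTypeFaces m n ∪ wrapFaces m n ∪ rowFaces m n).ncard = n * (m - 1) + 1 := by
  have hz : ((0 : Fin n) : ℕ) = 0 := by simp
  have h1 : Disjoint (pathTypeFaces m n) (wrapFaces m n) := by
    rw [Set.disjoint_left]
    rintro σ ⟨i, hi, j', j, hj, h⟩ ⟨a, ha, l, hl, h'⟩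
    have e : ({(i, j'), (i, j)} : Finset (Fin m × Fin n)) = {(a, 0), (a, l)} := by
      apply cutFace_injOn (by simp [Ne.symm hi]) (by simp [Ne.symm ha])
      rw [cutFace, cutFace, ← h, ← h']
    have e1 : (a, (0 : Fin n)) ∈ ({(i, j'), (i, j)} : Finset (Fin m × Fin n)) := by simp [e]
    have e2 : (a, l) ∈ ({(i, j'), (i, j)} : Finset (Fin m × Fin n)) := by simp [e]
    simp only [Finset.mem_insert, Finset.mem_singleton, Prod.mk.injEq, Fin.ext_iff] at e1 e2
    omega
  have h2 : Disjoint (pathTypeFaces m n ∪ wrapFaces m n) (rowFaces m n) := by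
    rw [Set.disjoint_left]
    rintro σ hσ ⟨l', l, hl', hl, h'⟩
    have : ∃ i : Fin m, i ≠ 0 ∧ ∃ j : Fin n, (i, j) ∈ σᶜ := by
      rcases hσ with ⟨i, hi, j', j, hj, h⟩ | ⟨i, hi, l, hl, h⟩
      · exact ⟨i, hi, j, by simp [h]⟩
      · exact ⟨i, hi, l, by simp [h]⟩
    obtain ⟨i, hi, j, hj⟩ := this
    simp [h', hi] at hj
  rw [Set.ncard_union_eq h2, Set.ncard_union_eq h1, ncard_pathTypeFaces, ncard_wrapFaces (by omega),
    ncard_rowFaces (by omega)]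
  obtain ⟨k, rfl⟩ : ∃ k, m = k + 1 := ⟨m - 1, by omega⟩
  obtain ⟨l, rfl⟩ : ∃ l, n = l + 1 := ⟨n - 1, by omega⟩
  simp only [Nat.add_sub_cancel]
  ring

theorem card_of_mem_criticalFaces (hn : 4 ≤ n) {σ : Finset (Fin m × Fin n)}
    (hσ : σ ∈ pathTypeFaces m n ∪ wrapFaces m n ∪ rowFaces m n) : σ.card = m * n - 3 := by
  rw [criticalFaces_eq] at hσ
  obtain ⟨B, hB, rfl⟩ := hσ
  exact card_cutFace (hB.isRelativeCell hn).1.notMem (hB.card_eq hn)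

/-! ### Collapsing the complex to a cone with simplices attached -/

/-- The faces of the total cut complex that contain a given relative cell. -/
theorem exists_subset_of_cutFace_subset {B σ : Finset (Fin m × Fin n)} (hB : IsRelativeCell B)
    (hσ : σ ∈ totalCutComplex 2 (completeBoxCycle m n)) (h : cutFace B ⊆ σ) :
    ∃ B' ⊆ B, IsRelativeCell B' ∧ σ = cutFace B' := by
  obtain ⟨h1, h2⟩ := (insert_mem_totalCutComplex_or hσ).resolve_left fun hins =>
    insert_cutFace_notMem hB
      ((totalCutComplex 2 (completeBoxCycle m n)).lower (Finset.insert_subset_insert _ h) hins)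
  refine ⟨_, fun u hu => ?_, h1, h2⟩
  by_contra hn
  simp only [Finset.mem_compl, Finset.mem_insert, not_or] at hu
  exact hu.2 (h (mem_cutFace.2 ⟨hu.1, hn⟩))

/-- The complex that remains after removing the row pairs with index less than `a`. -/
def rowRemoved (m : ℕ) {n : ℕ} [NeZero m] [NeZero n] (hn : 4 ≤ n) (a : ℕ) :
    LowerSet (Finset (Fin m × Fin n)) where
  carrier := {σ | σ ∈ totalCutComplex 2 (completeBoxCycle m n) ∧
    ∀ k : Fin n, k.val < a → ∀ B, IsRowPair k B → σ ≠ cutFace B}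
  lower' := by
    rintro σ ρ hρσ ⟨hσ, h⟩
    refine ⟨LowerSet.lower _ hρσ hσ, ?_⟩
    rintro k hk B hB rfl
    obtain ⟨B', hsub, hB', rfl⟩ := exists_subset_of_cutFace_subset (hB.isRelativeCell hn) hσ hρσ
    obtain ⟨h1, h3, l, hl, he⟩ := id hB
    by_cases hlB : (0, l) ∈ B'
    · refine h k hk B' ⟨h1, h3, l, hl, ?_⟩ rfl
      apply Finset.Subset.antisymm
      · rw [← he]
        exact Finset.erase_subset_erase _ hsub
      · rw [Finset.singleton_subset_iff, Finset.mem_erase]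
        refine ⟨?_, hlB⟩
        simp only [ne_eq, Prod.mk.injEq, true_and, Fin.ext_iff]
        omega
    -- Here `B'` is contained in `{(0, k)}`, so it belongs to a row pair of smaller index, already
    -- removed. Increasing order thus keeps the family a complex.
    · obtain ⟨k', hk', hr⟩ := hB'.isRowPair_of_subset hn (k := k) fun b hb => by
        by_contra hne
        have : b ∈ B.erase (0, k) := Finset.mem_erase.2 ⟨hne, hsub hb⟩
        rw [he, Finset.mem_singleton] at this
        exact hlB (this ▸ hb)
      exact h k' (lt_trans hk' hk) B' hr rfl

/-- The complex that remains after removing all row pairs and the column pairs with index less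
than `a`. -/
def columnRemoved (m : ℕ) {n : ℕ} [NeZero m] [NeZero n] (hn : 4 ≤ n) (a : ℕ) :
    LowerSet (Finset (Fin m × Fin n)) where
  carrier := {σ | σ ∈ rowRemoved m hn n ∧
    ∀ k : Fin n, k.val < a → ∀ B, IsColumnPair k B → σ ≠ cutFace B}
  lower' := by
    rintro σ ρ hρσ ⟨hσ, h⟩
    refine ⟨LowerSet.lower _ hρσ hσ, ?_⟩
    rintro k hk B hB rfl
    obtain ⟨B', hsub, hB', rfl⟩ := exists_subset_of_cutFace_subset (hB.isRelativeCell hn) hσ.1 hρσ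
    by_cases hne : (B'.erase (0, k)).Nonempty
    · exact h k hk B' ⟨hB.1, hne, fun b hb => hB.mem.2 b (hsub (Finset.mem_of_mem_erase hb))⟩ rfl
    -- The only subcell of a column pair that is not in a column pair is `{(0, k)}`. It lies in a
    -- row pair, hence has gone before the columns are treated.
    · obtain ⟨k', -, hr⟩ := hB'.isRowPair_of_subset hn (k := k) fun b hb => by
        by_contra hbk
        exact hne ⟨b, Finset.mem_erase.2 ⟨hbk, hb⟩⟩
      exact hσ.2 k' k'.isLt B' hr rfl

/-- The vertex `(1, 0)` is in no cell of a row or column pair, so every removed face contains it.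
This provides the condition `∅ ∈ L` of `toggle_collapse`. -/
theorem empty_ne_cutFace (hm : 2 ≤ m) {B : Finset (Fin m × Fin n)}
    (h : ∀ b ∈ B, b.1 = 0 ∨ b.2 ≠ 0) : ∅ ≠ cutFace B := by
  intro he
  have h1 : ((⟨1, hm⟩ : Fin m), (0 : Fin n)) ∉ cutFace B := by
    rw [← he]; exact Finset.notMem_empty _
  have h0 : (⟨1, hm⟩ : Fin m) ≠ 0 := by
    rw [ne_eq, Fin.ext_iff]; simp
  rw [mem_cutFace] at h1
  simp only [ne_eq, Prod.mk.injEq, h0, false_and, not_false_eq_true, true_and, not_not] at h1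
  rcases h _ h1 with h2 | h2
  · exact h0 h2
  · exact h2 rfl

theorem empty_mem_columnRemoved (hm : 2 ≤ m) (hn : 4 ≤ n) (a : ℕ) :
    ∅ ∈ columnRemoved m hn a := by
  refine ⟨⟨?_, fun k _ B hB => ?_⟩, fun k _ B hB => ?_⟩
  · refine mem_totalCutComplex_two.2 ⟨(0, 0), (0, ⟨2, by omega⟩), by simp, by simp, ?_, ?_⟩
    · simp [Fin.ext_iff]
    · rw [completeBoxCycle_adj (by omega)]
      simp
      omega
  · obtain ⟨l, -, -, hall⟩ := hB.mem
    refine empty_ne_cutFace hm fun b hb => Or.inl ?_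
    rcases hall b hb with rfl | rfl <;> rfl
  · refine empty_ne_cutFace hm fun b hb => Or.inr fun h0 => ?_
    have h1 := hB.1
    rw [← hB.mem.2 b hb, h0] at h1
    simp at h1

theorem rowRemoved_collapse (hm : 2 ≤ m) (hn : 4 ≤ n) (j : Fin n) :
    Nonempty (geometricRealization (rowRemoved m hn j.val) ≃ₕ
      geometricRealization (rowRemoved m hn (j.val + 1))) := by
  refine toggle_collapse (0, j) (fun σ hσ => ⟨hσ.1, fun k hk => hσ.2 k (by omega)⟩)
    ⟨(empty_mem_columnRemoved hm hn 0).1.1,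
      fun k _ => (empty_mem_columnRemoved hm hn 0).1.2 k k.isLt⟩ fun σ hσ hσ' => ?_
  have : ∃ B, IsRowPair j B ∧ σ = cutFace B := by
    by_contra! hno
    refine hσ' ⟨hσ.1, fun k hk B hB => ?_⟩
    rcases Nat.lt_succ_iff_lt_or_eq.1 hk with hk | hk
    · exact hσ.2 k hk B hB
    · rw [Fin.ext hk] at hB
      exact hno B hB
  obtain ⟨B, hB, rfl⟩ := this
  constructor
  · rw [insert_cutFace _ (vertex_ne_zero hB.1)]
    have hs := hB.erase.isRelativeCell hn
    refine ⟨cutFace_mem_totalCutComplex hs, fun k hk B' hB' he => ?_⟩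
    rw [← cutFace_injOn hs.notMem (hB'.isRelativeCell hn).notMem he] at hB'
    exact hk.ne (congrArg _ (hB'.unique hB.erase))
  · rw [erase_cutFace]
    exact fun h => h.2 j (by omega) _ hB.insert rfl

theorem columnRemoved_collapse (hm : 2 ≤ m) (hn : 4 ≤ n) (j : Fin n) :
    Nonempty (geometricRealization (columnRemoved m hn j.val) ≃ₕ
      geometricRealization (columnRemoved m hn (j.val + 1))) := by
  refine toggle_collapse (0, j) (fun σ hσ => ⟨hσ.1, fun k hk => hσ.2 k (by omega)⟩)
    (empty_mem_columnRemoved hm hn _) fun σ hσ hσ' => ?_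
  have : ∃ B, IsColumnPair j B ∧ σ = cutFace B := by
    by_contra! hno
    refine hσ' ⟨hσ.1, fun k hk B hB => ?_⟩
    rcases Nat.lt_succ_iff_lt_or_eq.1 hk with hk | hk
    · exact hσ.2 k hk B hB
    · rw [Fin.ext hk] at hB
      exact hno B hB
  obtain ⟨B, hB, rfl⟩ := this
  constructor
  · rw [insert_cutFace _ (vertex_ne_zero hB.1)]
    have hs := hB.erase.isRelativeCell hn
    refine ⟨⟨cutFace_mem_totalCutComplex hs, fun k hk B' hB' he => ?_⟩,
      fun k hk B' hB' he => ?_⟩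
    · rw [← cutFace_injOn hs.notMem (hB'.isRelativeCell hn).notMem he] at hB'
      exact hB.erase.not_isRowPair hB'
    · rw [← cutFace_injOn hs.notMem (hB'.isRelativeCell hn).notMem he] at hB'
      exact hk.ne (congrArg _ (hB'.unique hB.erase))
  · rw [erase_cutFace]
    exact fun h => h.2 j (by omega) _ hB.insert rfl

/-- Composition of a finite sequence of homotopy equivalences. -/
theorem homotopyEquiv_of_steps {X : ℕ → Type*} [∀ a, TopologicalSpace (X a)] {n : ℕ}
    (h : ∀ j < n, Nonempty (X j ≃ₕ X (j + 1))) : Nonempty (X 0 ≃ₕ X n) := by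
  induction n with
  | zero => exact ⟨ContinuousMap.HomotopyEquiv.refl _⟩
  | succ n ih =>
    obtain ⟨e⟩ := ih fun j hj => h j (by omega)
    obtain ⟨e'⟩ := h n (by omega)
    exact ⟨e.trans e'⟩

theorem totalCutComplex_collapse (hm : 2 ≤ m) (hn : 4 ≤ n) :
    Nonempty (geometricRealization (totalCutComplex 2 (completeBoxCycle m n)) ≃ₕ
      geometricRealization (columnRemoved m hn n)) := by
  have h0 : rowRemoved m hn 0 = totalCutComplex 2 (completeBoxCycle m n) :=
    le_antisymm (fun σ hσ => hσ.1) fun σ hσ => ⟨hσ, fun k hk => absurd hk (Nat.not_lt_zero _)⟩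
  have h1 : columnRemoved m hn 0 = rowRemoved m hn n :=
    le_antisymm (fun σ hσ => hσ.1) fun σ hσ => ⟨hσ, fun k hk => absurd hk (Nat.not_lt_zero _)⟩
  obtain ⟨e⟩ : Nonempty (geometricRealization (rowRemoved m hn 0) ≃ₕ
      geometricRealization (rowRemoved m hn n)) :=
    homotopyEquiv_of_steps (X := fun a => geometricRealization (rowRemoved m hn a)) fun j hj =>
      rowRemoved_collapse hm hn ⟨j, hj⟩
  obtain ⟨e'⟩ : Nonempty (geometricRealization (columnRemoved m hn 0) ≃ₕ
      geometricRealization (columnRemoved m hn n)) :=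
    homotopyEquiv_of_steps (X := fun a => geometricRealization (columnRemoved m hn a)) fun j hj =>
      columnRemoved_collapse hm hn ⟨j, hj⟩
  rw [h0] at e
  rw [h1] at e'
  exact ⟨e.trans e'⟩

theorem cutFace_mem_columnRemoved (hn : 4 ≤ n) {B : Finset (Fin m × Fin n)}
    (hB : IsRelativeCell B) : cutFace B ∈ columnRemoved m hn n ↔ IsCriticalCell B := by
  constructor
  · intro h
    exact hB.isCriticalCell hn (fun k hk => h.1.2 k k.isLt B hk rfl)
      fun k hk => h.2 k k.isLt B hk rfl
  · intro h
    obtain ⟨-, h2, h3⟩ := h.isRelativeCell hn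
    refine ⟨⟨cutFace_mem_totalCutComplex hB, fun k _ B' hB' he => ?_⟩, fun k _ B' hB' he => ?_⟩
    · rw [← cutFace_injOn hB.notMem (hB'.isRelativeCell hn).notMem he] at hB'
      exact h2 k hB'
    · rw [← cutFace_injOn hB.notMem (hB'.isRelativeCell hn).notMem he] at hB'
      exact h3 k hB'

theorem columnRemoved_homotopyEquiv (hm : 2 ≤ m) (hn : 4 ≤ n) :
    Nonempty (geometricRealization (columnRemoved m hn n) ≃ₕ
      WedgeOfSpheres (n * (m - 1) + 1) (m * n - 4)) := by
  classical
  have hmn : 8 ≤ m * n := Nat.mul_le_mul hm hn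
  let crit : Finset (Finset (Fin m × Fin n)) :=
    Finset.univ.filter fun σ => σ ∈ pathTypeFaces m n ∪ wrapFaces m n ∪ rowFaces m n
  have hcard : crit.card = n * (m - 1) + 1 := by
    rw [← ncard_criticalFaces (by omega) hn, ← Set.ncard_coe_finset]
    congr 1
    ext σ
    simp [crit]
  let C : Fin (n * (m - 1) + 1) → Finset (Fin m × Fin n) := fun i =>
    ((crit.equivFinOfCardEq hcard).symm i : crit)
  have hC : ∀ i, ∃ B, IsCriticalCell B ∧ C i = cutFace B := by
    intro i
    have := ((crit.equivFinOfCardEq hcard).symm i).2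
    rw [Finset.mem_filter, criticalFaces_eq] at this
    exact this.2
  have hCsurj : ∀ B, IsCriticalCell B → ∃ i, cutFace B = C i := by
    intro B hB
    refine ⟨crit.equivFinOfCardEq hcard ⟨cutFace B, ?_⟩, by simp [C]⟩
    rw [Finset.mem_filter, criticalFaces_eq]
    exact ⟨Finset.mem_univ _, B, hB, rfl⟩
  apply homotopyEquiv_wedgeOfSpheres (0, 0) (Nat.succ_ne_zero _) C
  · exact Subtype.val_injective.comp (Equiv.injective _)
  · intro i
    obtain ⟨B, hB, he⟩ := hC i
    rw [he]
    exact (cutFace_mem_columnRemoved hn (hB.isRelativeCell hn).1).2 hB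
  · intro i σ hσ hsub
    obtain ⟨B, hB, he⟩ := hC i
    rw [he] at hsub ⊢
    obtain ⟨B', hsub', hB', rfl⟩ :=
      exists_subset_of_cutFace_subset (hB.isRelativeCell hn).1 hσ.1.1 hsub
    have hcrit := (cutFace_mem_columnRemoved hn hB').1 hσ
    -- A larger face corresponds to a smaller critical cell, but all critical cells have two
    -- vertices.
    rw [Finset.eq_of_subset_of_card_le hsub' (by rw [hB.card_eq hn, hcrit.card_eq hn])]
  · intro i
    obtain ⟨B, hB, he⟩ := hC i
    rw [he, card_cutFace (hB.isRelativeCell hn).1.notMem (hB.card_eq hn)]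
    omega
  · intro i
    obtain ⟨B, hB, he⟩ := hC i
    simp [he, mem_cutFace]
  · intro σ hσ
    rcases insert_mem_totalCutComplex_or hσ.1.1 with h | ⟨h, he⟩
    · right
      -- No `cutFace` contains `(0, 0)`, so the collapses leave the star of `(0, 0)` intact.
      have hne : ∀ B : Finset (Fin m × Fin n), insert (0, 0) σ ≠ cutFace B := by
        intro B he
        have h1 : ((0 : Fin m), (0 : Fin n)) ∈ cutFace B := he ▸ Finset.mem_insert_self _ _
        exact (mem_cutFace.1 h1).1 rfl
      exact ⟨⟨h, fun k _ B _ => hne B⟩, fun k _ B _ => hne B⟩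
    · left
      rw [he] at hσ ⊢
      have hcut := (cutFace_mem_columnRemoved hn h).1 hσ
      exact hCsurj _ hcut

end ProductMatching

theorem theorem3p11 (m n : ℕ) [NeZero m] [NeZero n] (hm : 2 ≤ m) (hn : 4 ≤ n) :
    Nonempty (geometricRealization (totalCutComplex 2 (completeBoxCycle m n)) ≃ₕ
      WedgeOfSpheres (n * (m - 1) + 1) (m * n - 4)) ∧
    IsAcyclicMatching
      (totalCutComplex 2 (completeBoxCycle m n) : Set (Finset (Fin m × Fin n)))
      (productMatching m n) ∧
    criticalSets
      (totalCutComplex 2 (completeBoxCycle m n) : Set (Finset (Fin m × Fin n)))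
      (productMatching m n) = pathTypeFaces m n ∪ wrapFaces m n ∪ rowFaces m n ∧
    (pathTypeFaces m n).ncard = (m - 1) * (n - 1) ∧
    (wrapFaces m n).ncard = m - 1 ∧
    (rowFaces m n).ncard = 1 ∧
    (pathTypeFaces m n ∪ wrapFaces m n ∪ rowFaces m n).ncard = n * (m - 1) + 1 ∧
    ∀ σ ∈ pathTypeFaces m n ∪ wrapFaces m n ∪ rowFaces m n, σ.card = m * n - 3 := by
  obtain ⟨e⟩ := totalCutComplex_collapse hm hn
  obtain ⟨e'⟩ := columnRemoved_homotopyEquiv hm hn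
  exact ⟨⟨e.trans e'⟩,
    isAcyclicMatching_sequentialMatching (totalCutComplex 2 (completeBoxCycle m n)).lower _,
    criticalSets_productMatching hn, ncard_pathTypeFaces, ncard_wrapFaces (by omega),
    ncard_rowFaces (by omega), ncard_criticalFaces (by omega) hn,
    fun _ hσ => card_of_mem_criticalFaces hn hσ⟩
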